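/- **Proposition 4.1.** Let $\mathcal H$ be a finite-dimensional complex Hilbert space. An effect on $\mathcal H$ is an operator $A$ with $0\le A\le \mathbb 1$, and $A^\perp:=\mathbb 1-A$. Two effects $A,B$ are *coexistent* if there is an observable (normalized positive operator valued measure) $\mathsf G$ on some measurable space and measurable sets $X,Y$ with $A=\mathsf G(X)$ and $B=\mathsf G(Y)$. A *joint observable* of $A$ and $B$ consists of four effects $G_1,\dots,G_4$ with $G_1+G_2=A$, $G_1+G_3=B$ and $G_1+G_2+G_3+G_4=\mathbb 1$. For matrices $A=\tfrac12(\alpha\mathbb 1+\mathbf a\cdot\boldsymbol\sigma)$ and $B=\tfrac12(\beta\mathbb 1+\mathbf b\cdot\boldsymbol\sigma)$ on $\mathbb C^2$ with $\alpha,\beta\in\mathbb R$, $\mathbf a,\mathbf b\in\mathbb R^3$ and $\boldsymbol\sigma$ the vector of Pauli matrices, put $\langle A|B\rangle:=\alpha\beta-\mathbf a\cdot\mathbf b$, and for effects $A,B$ on $\mathbb C^2$ put $$\mathfrak c(A,B):=\big[\langle A|A\rangle\langle A^\perp|A^\perp\rangle\langle B|B\rangle\langle B^\perp|B^\perp\rangle\big]^{1/2}-\langle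 A|A^\perp\rangle\langle B|B^\perp\rangle+\langle A|B^\perp\rangle\langle A^\perp|B\rangle+\langle A|B\rangle\langle A^\perp|B^\perp\rangle .$$ Let $P_1,P_2$ be orthogonal projections on $\mathcal H$ and let $\mathcal A$ be the von Neumann algebra generated by $P_1$, $P_2$ and $\mathbb 1$. Put $\mathcal K:=\ker([P_1,P_2])^\perp$, $\mathcal K_0:=\{\varphi\in\mathcal K\mid P_1\varphi=\varphi\}$, $C:=\mathbb 1-(P_1-P_2)^2$ (which leaves $\mathcal K_0$ invariant), and let $\Theta:=\arccos(2C|_{\mathcal K_0}-\mathbb 1)$ be the angle operator on $\mathcal K_0$, with finite spectrum $\operatorname{spec}\Theta\subset(0,\pi)$ and eigenspaces $\mathcal H_\theta:=\ker(\Theta-\theta)\subset\mathcal K_0$. For $\theta\in\operatorname{spec}\Theta$ identify $\mathcal H_\theta\otimes\mathbb C^2$ isometrically with a subspace of $\mathcal K$ by $$\psi\otimes(x_0,x_1)\;\mapsto\; x_0\psi+x_1\tfrac{2}{\sin\theta}P_1^\perp P_2\psi .$$ Every $A\in\mathcal A$ acts on this subspace as $\mathbb 1_{\mathcal H_\theta}\otimes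 M_A(\theta)$ for a unique complex $2\times2$ matrix $M_A(\theta)$; in particular $M_{P_1}(\theta)=\tfrac12(\mathbb 1+\sigma_z)$ and $M_{P_2}(\theta)=\tfrac12(\mathbb 1+\sin\theta\,\sigma_x+\cos\theta\,\sigma_z)$. Let $A,B\in\mathcal A$ be effects. Then $A$ and $B$ are coexistent if and only if $$\mathfrak c(M_A(\theta),M_B(\theta))\ge 0\quad\text{for all }\theta\in\operatorname{spec}\Theta .$$ In that case, $A$ and $B$ have a joint observable whose effects are all contained in $\mathcal A$. -/

import Mathlib

open scoped InnerProductSpace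

universe u v

namespace TwoProjections

section Coexistence

variable {H : Type u} [NormedAddCommGroup H] [InnerProductSpace ℂ H]

/-- An effect: `0 ≤ A ≤ 1` in the (Loewner) operator order. -/
def IsEffect (A : H →L[ℂ] H) : Prop :=
  0 ≤ A ∧ A ≤ 1

/-- An observable (normalised positive operator valued measure) on a measurable space `Ω`.
Only the values on measurable sets are meaningful. The `σ`-additivity is in the weak sense; as all
partial sums lie in the unit ball, this is the same as weak-* `σ`-additivity. -/
structure Observable (Ω : Type v) [MeasurableSpace Ω] (H : Type u) [NormedAddCommGroup H]
    [InnerProductSpace ℂ H] where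
  toFun : Set Ω → (H →L[ℂ] H)
  isEffect : ∀ X, MeasurableSet X → IsEffect (toFun X)
  univ : toFun Set.univ = 1
  hasSum : ∀ X : ℕ → Set Ω, (∀ n, MeasurableSet (X n)) →
    (∀ m n, m ≠ n → Disjoint (X m) (X n)) →
    ∀ φ ψ : H, HasSum (fun n => ⟪φ, toFun (X n) ψ⟫_ℂ) ⟪φ, toFun (⋃ n, X n) ψ⟫_ℂ

/-- `A` and `B` are coexistent: both are in the range of one observable, with an arbitrary
outcome space (in an arbitrary universe `v`). -/
def Coexistent (A B : H →L[ℂ] H) : Prop :=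
  ∃ (Ω : Type v) (_ : MeasurableSpace Ω) (G : Observable Ω H) (X Y : Set Ω),
    MeasurableSet X ∧ MeasurableSet Y ∧ A = G.toFun X ∧ B = G.toFun Y

/-- The effects `G 0, G 1, G 2, G 3` form a (four-outcome) joint observable of `A` and `B`. -/
def IsJointObservable (G : Fin 4 → (H →L[ℂ] H)) (A B : H →L[ℂ] H) : Prop :=
  (∀ i, IsEffect (G i)) ∧ G 0 + G 1 = A ∧ G 0 + G 2 = B ∧ G 0 + G 1 + G 2 + G 3 = 1

end Coexistence

section Qubit

open Matrix

/-- The Pauli matrices `σ_x, σ_y, σ_z`. -/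
noncomputable def pauli : Fin 3 → Matrix (Fin 2) (Fin 2) ℂ :=
  ![!![0, 1; 1, 0], !![0, -Complex.I; Complex.I, 0], !![1, 0; 0, -1]]

/-- For `A = (α 1 + a · σ) / 2` with `α` and `a` real, this is `α`. -/
noncomputable def blochScalar (A : Matrix (Fin 2) (Fin 2) ℂ) : ℝ :=
  A.trace.re

/-- For `A = (α 1 + a · σ) / 2` with `α` and `a` real, this is `a`. -/
noncomputable def blochVec (A : Matrix (Fin 2) (Fin 2) ℂ) (i : Fin 3) : ℝ :=
  (A * pauli i).trace.re

theorem bloch_of_param (α : ℝ) (a : Fin 3 → ℝ) (A : Matrix (Fin 2) (Fin 2) ℂ)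
    (hA : A = (1 / 2 : ℂ) • ((α : ℂ) • (1 : Matrix (Fin 2) (Fin 2) ℂ)
      + ∑ i, (a i : ℂ) • pauli i)) :
    blochScalar A = α ∧ blochVec A = a := by
  subst hA
  refine ⟨?_, ?_⟩
  · simp [blochScalar, pauli, Fin.sum_univ_three, Matrix.trace]
    ring
  · ext i
    fin_cases i <;>
      simp [blochVec, pauli, Fin.sum_univ_three, Matrix.trace, Matrix.mul_apply,
        Matrix.one_apply] <;> ring

/-- `⟨A|B⟩ = α β - a · b`. -/
noncomputable def blochForm (A B : Matrix (Fin 2) (Fin 2) ℂ) : ℝ :=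
  blochScalar A * blochScalar B - ∑ i, blochVec A i * blochVec B i

/-- The coexistence function `𝔠` of two qubit effects; the complement `Aᗮ` is `1 - A`. -/
noncomputable def coexFun (A B : Matrix (Fin 2) (Fin 2) ℂ) : ℝ :=
  Real.sqrt (blochForm A A * blochForm (1 - A) (1 - A) * blochForm B B * blochForm (1 - B) (1 - B))
    - blochForm A (1 - A) * blochForm B (1 - B)
    + blochForm A (1 - B) * blochForm (1 - A) B
    + blochForm A B * blochForm (1 - A) (1 - B)

end Qubit

section Algebra

set_option linter.unusedSectionVars false

variable {H : Type u} [NormedAddCommGroup H] [InnerProductSpace ℂ H] [CompleteSpace H]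

/-- The von Neumann algebra generated by a set of operators (and the identity). -/
noncomputable def vonNeumannGenerated (S : Set (H →L[ℂ] H)) : VonNeumannAlgebra H where
  toStarSubalgebra := StarSubalgebra.centralizer ℂ (StarSubalgebra.centralizer ℂ S : Set (H →L[ℂ] H))
  centralizer_centralizer' := by
    change Set.centralizer (Set.centralizer (StarSubalgebra.centralizer ℂ
      (StarSubalgebra.centralizer ℂ S : Set (H →L[ℂ] H)) : Set (H →L[ℂ] H))) =
      (StarSubalgebra.centralizer ℂ
      (StarSubalgebra.centralizer ℂ S : Set (H →L[ℂ] H)) : Set (H →L[ℂ] H))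
    rw [StarSubalgebra.coe_centralizer_centralizer, Set.centralizer_centralizer_centralizer]

/-- It is the double commutant of the star-closure of the set. -/
theorem coe_vonNeumannGenerated (S : Set (H →L[ℂ] H)) :
    (vonNeumannGenerated S : Set (H →L[ℂ] H)) = (S ∪ star S).centralizer.centralizer :=
  StarSubalgebra.coe_centralizer_centralizer ℂ S

/-- It is the smallest von Neumann algebra that contains the set. -/
theorem isLeast_vonNeumannGenerated (S : Set (H →L[ℂ] H)) :
    IsLeast {N : VonNeumannAlgebra H | S ⊆ (N : Set (H →L[ℂ] H))} (vonNeumannGenerated S) := by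
  constructor
  · change S ⊆ (vonNeumannGenerated S : Set (H →L[ℂ] H))
    rw [coe_vonNeumannGenerated]
    exact Set.subset_union_left.trans Set.subset_centralizer_centralizer
  · intro N hN
    change (vonNeumannGenerated S : Set (H →L[ℂ] H)) ⊆ (N : Set (H →L[ℂ] H))
    rw [coe_vonNeumannGenerated, ← N.centralizer_centralizer]
    refine Set.centralizer_subset (Set.centralizer_subset (Set.union_subset hN ?_))
    intro x hx
    have := star_mem (hN hx : star x ∈ N)
    simpa using this

/-- The support `𝒦 = (ker [P₁, P₂])ᗮ` of the commutator. -/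
noncomputable def suppComm (P₁ P₂ : H →L[ℂ] H) : Submodule ℂ H :=
  (LinearMap.ker (P₁ * P₂ - P₂ * P₁ : H →L[ℂ] H).toLinearMap)ᗮ

/-- The central element `C = 1 - (P₁ - P₂)²`. -/
noncomputable def centralC (P₁ P₂ : H →L[ℂ] H) : H →L[ℂ] H :=
  1 - (P₁ - P₂) ^ 2

/-- `𝒦₀ = {φ ∈ 𝒦 | P₁ φ = φ}`. -/
noncomputable def suppZero (P₁ P₂ : H →L[ℂ] H) : Submodule ℂ H :=
  suppComm P₁ P₂ ⊓ LinearMap.eqLocus P₁.toLinearMap LinearMap.id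

instance completeSpace_suppZero (P₁ P₂ : H →L[ℂ] H) : CompleteSpace (suppZero P₁ P₂) := by
  refine IsClosed.completeSpace_coe (hs := ?_)
  have h : (suppZero P₁ P₂ : Set H) = (suppComm P₁ P₂ : Set H) ∩ {x | P₁ x = x} := rfl
  rw [h]
  exact (Submodule.isClosed_orthogonal _).inter (isClosed_eq P₁.continuous continuous_id)

/-- The compression of `C` to its invariant subspace `𝒦₀`. -/
noncomputable def compressedC (P₁ P₂ : H →L[ℂ] H) : suppZero P₁ P₂ →L[ℂ] suppZero P₁ P₂ :=
  (suppZero P₁ P₂).orthogonalProjectionOnto ∘L centralC P₁ P₂ ∘L (suppZero P₁ P₂).subtypeL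

/-- The operator `arccos (2 T - 1)`, by the continuous functional calculus. -/
noncomputable def arccosOp (T : H →L[ℂ] H) : H →L[ℂ] H :=
  cfc Real.arccos (2 * T - 1)

/-- The angle operator `Θ = arccos (2 C|_{𝒦₀} - 1)` on `𝒦₀`. -/
noncomputable def angleOp (P₁ P₂ : H →L[ℂ] H) : suppZero P₁ P₂ →L[ℂ] suppZero P₁ P₂ :=
  arccosOp (compressedC P₁ P₂)

/-- The identification of `ℋ_θ ⊗ ℂ²` with a subspace of `𝒦`, on elementary tensors `ψ ⊗ x`. Here
`ψ ⊗ e₀` is `ψ ∈ 𝒦₀` and `ψ ⊗ e₁` is `(2 / sin θ) P₁ᗮ P₂ ψ ∈ 𝒦₁`. -/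
noncomputable def tensorVec (P₁ P₂ : H →L[ℂ] H) (θ : ℝ) (ψ : suppZero P₁ P₂) (x : Fin 2 → ℂ) : H :=
  x 0 • (ψ : H) + x 1 • ((2 / Real.sin θ : ℝ) : ℂ) • (1 - P₁) (P₂ (ψ : H))

/-- `A` acts as `1 ⊗ M` on `ℋ_θ ⊗ ℂ²`, where `ℋ_θ` is the eigenspace of `Θ` at `θ`. -/
def IsFiber (P₁ P₂ A : H →L[ℂ] H) (θ : ℝ) (M : Matrix (Fin 2) (Fin 2) ℂ) : Prop :=
  ∀ ψ : suppZero P₁ P₂, angleOp P₁ P₂ ψ = (θ : ℂ) • ψ →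
    ∀ x : Fin 2 → ℂ, A (tensorVec P₁ P₂ θ ψ x) = tensorVec P₁ P₂ θ ψ (M.mulVec x)

/-- The matrix `M_A(θ)`: the `M` such that `A` acts as `1 ⊗ M` on `ℋ_θ ⊗ ℂ²`. For `A`
in the algebra and `θ` in the spectrum it exists and is unique, see `existsUnique_isFiber`. -/
noncomputable def fiber (P₁ P₂ A : H →L[ℂ] H) (θ : ℝ) : Matrix (Fin 2) (Fin 2) ℂ :=
  Classical.epsilon (IsFiber P₁ P₂ A θ)

theorem arccosOp_apply_eq {T : H →L[ℂ] H} (h0 : 0 ≤ T) (h1 : T ≤ 1) {θ : ℝ} {ψ : H}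
    (h : arccosOp T ψ = (θ : ℂ) • ψ) : T ψ = (((1 + Real.cos θ) / 2 : ℝ) : ℂ) • ψ := by
  have hT : IsSelfAdjoint T := IsSelfAdjoint.of_nonneg h0
  have hS : IsSelfAdjoint (2 * T - 1) := by
    rw [two_mul]
    exact (hT.add hT).sub (.one _)
  have hspec : ∀ x ∈ spectrum ℝ (2 * T - 1), -1 ≤ x ∧ x ≤ 1 := by
    have hl : algebraMap ℝ (H →L[ℂ] H) (-1) ≤ 2 * T - 1 := by
      have : 0 ≤ 2 * T - 1 - algebraMap ℝ (H →L[ℂ] H) (-1) := by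
        have e : 2 * T - 1 - algebraMap ℝ (H →L[ℂ] H) (-1) = T + T := by
          simp [two_mul]
        rw [e]; exact add_nonneg h0 h0
      exact sub_nonneg.mp this
    have hr : 2 * T - 1 ≤ algebraMap ℝ (H →L[ℂ] H) 1 := by
      have : 0 ≤ algebraMap ℝ (H →L[ℂ] H) 1 - (2 * T - 1) := by
        have e : algebraMap ℝ (H →L[ℂ] H) 1 - (2 * T - 1) = (1 - T) + (1 - T) := by
          rw [map_one, two_mul]; abel
        rw [e]; exact add_nonneg (sub_nonneg.mpr h1) (sub_nonneg.mpr h1)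
      exact sub_nonneg.mp this
    intro x hx
    exact ⟨(algebraMap_le_iff_le_spectrum hS).mp hl x hx, (le_algebraMap_iff_spectrum_le hS).mp hr x hx⟩
  have hΘ : IsSelfAdjoint (arccosOp T) := cfc_predicate _ _
  have hcos : cfc Real.cos (arccosOp T) = 2 * T - 1 := by
    unfold arccosOp
    rw [← cfc_comp' Real.cos Real.arccos (2 * T - 1)]
    conv_rhs => rw [← cfc_id ℝ (2 * T - 1)]
    exact cfc_congr fun x hx => Real.cos_arccos (hspec x hx).1 (hspec x hx).2
  have hd : Continuous (dslope Real.cos θ) := by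
    refine continuous_iff_continuousAt.mpr fun x => ?_
    by_cases hx : x = θ
    · subst hx; exact continuousAt_dslope_same.mpr Real.differentiable_cos.differentiableAt
    · exact (continuousAt_dslope_of_ne hx).mpr Real.continuous_cos.continuousAt
  have hsplit : cfc Real.cos (arccosOp T) - algebraMap ℝ _ (Real.cos θ) =
      cfc (dslope Real.cos θ) (arccosOp T) * (arccosOp T - algebraMap ℝ _ θ) := by
    have e1 : arccosOp T - algebraMap ℝ _ θ = cfc (fun x : ℝ => x - θ) (arccosOp T) := by
      rw [cfc_sub (fun x : ℝ => x) (fun _ => θ) (arccosOp T), cfc_id' ℝ (arccosOp T),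
        cfc_const θ (arccosOp T)]
    rw [e1, ← cfc_mul _ _ (arccosOp T) hd.continuousOn, ← cfc_const (Real.cos θ) (arccosOp T),
      ← cfc_sub Real.cos (fun _ => Real.cos θ) (arccosOp T)]
    refine cfc_congr fun x _ => ?_
    have := sub_smul_dslope Real.cos θ x
    simp only [smul_eq_mul] at this
    simp only [← this]; ring
  rw [hcos] at hsplit
  have := congrArg (fun L : H →L[ℂ] H => L ψ) hsplit
  have e2 : ∀ r : ℝ, (algebraMap ℝ (H →L[ℂ] H) r) ψ = (r : ℂ) • ψ := by
    intro r
    rw [Algebra.algebraMap_eq_smul_one]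
    change r • ψ = _
    exact (Complex.coe_smul r ψ).symm
  simp only [sub_apply, mul_apply_eq_comp, h, e2, sub_self,
    map_zero, two_mul, add_apply, one_apply_eq_self] at this
  have h2 : (2 : ℂ) • T ψ = (1 + (Real.cos θ : ℂ)) • ψ := by
    rw [two_smul, add_smul, one_smul, ← sub_eq_zero, ← this]; abel
  have h3 : T ψ = (2 : ℂ)⁻¹ • (2 : ℂ) • T ψ := by rw [inv_smul_smul₀ two_ne_zero]
  rw [h3, h2, smul_smul]
  congr 1
  push_cast; ring

theorem proj_apply_apply {P : H →L[ℂ] H} (hP : IsStarProjection P) (x : H) : P (P x) = P x :=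
  congrArg (fun L : H →L[ℂ] H => L x) hP.isIdempotentElem

theorem proj_inner {P : H →L[ℂ] H} (hP : IsStarProjection P) (x y : H) :
    ⟪P x, y⟫_ℂ = ⟪x, P y⟫_ℂ :=
  hP.isSelfAdjoint.isSymmetric x y

theorem proj_one_apply {P₁ P₂ : H →L[ℂ] H} (ψ : suppZero P₁ P₂) : P₁ (ψ : H) = ψ :=
  ψ.2.2

theorem suppComm_eq_zero {P₁ P₂ : H →L[ℂ] H} {x : H} (hx : x ∈ suppComm P₁ P₂)
    (h : P₁ (P₂ x) = P₂ (P₁ x)) : x = 0 := by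
  have : x ∈ LinearMap.ker (P₁ * P₂ - P₂ * P₁ : H →L[ℂ] H).toLinearMap := by
    change P₁ (P₂ x) - P₂ (P₁ x) = 0
    rw [h, sub_self]
  exact inner_self_eq_zero.mp (Submodule.inner_right_of_mem_orthogonal this hx)

theorem proj_mem_suppComm {P₁ P₂ : H →L[ℂ] H} (hP₁ : IsStarProjection P₁)
    (hP₂ : IsStarProjection P₂) {x : H} (hx : x ∈ suppComm P₁ P₂) :
    P₁ x ∈ suppComm P₁ P₂ ∧ P₂ x ∈ suppComm P₁ P₂ := by
  refine ⟨(Submodule.mem_orthogonal _ _).mpr fun y hy => ?_,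
    (Submodule.mem_orthogonal _ _).mpr fun y hy => ?_⟩
  · have hy' : P₁ (P₂ y) = P₂ (P₁ y) := sub_eq_zero.mp hy
    rw [← proj_inner hP₁]
    refine Submodule.inner_right_of_mem_orthogonal ?_ hx
    change P₁ (P₂ (P₁ y)) - P₂ (P₁ (P₁ y)) = 0
    rw [proj_apply_apply hP₁, ← hy', proj_apply_apply hP₁, sub_self]
  · have hy' : P₁ (P₂ y) = P₂ (P₁ y) := sub_eq_zero.mp hy
    rw [← proj_inner hP₂]
    refine Submodule.inner_right_of_mem_orthogonal ?_ hx
    change P₁ (P₂ (P₂ y)) - P₂ (P₁ (P₂ y)) = 0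
    rw [proj_apply_apply hP₂, hy', proj_apply_apply hP₂, sub_self]

/-- The compression of `C` to `𝒦₀` is the restriction of `C`, and of `P₁ P₂ P₁`. -/
theorem coe_compressedC {P₁ P₂ : H →L[ℂ] H} (hP₁ : IsStarProjection P₁)
    (hP₂ : IsStarProjection P₂) (ψ : suppZero P₁ P₂) :
    (compressedC P₁ P₂ ψ : H) = centralC P₁ P₂ ψ ∧ centralC P₁ P₂ ψ = P₁ (P₂ (P₁ ψ)) := by
  have hC : centralC P₁ P₂ ψ = P₁ (P₂ (P₁ ψ)) := by
    have : centralC P₁ P₂ ψ = (ψ : H) - (P₁ (P₁ ψ - P₂ ψ) - P₂ (P₁ ψ - P₂ ψ)) := by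
      rw [centralC, pow_two]; rfl
    rw [this, proj_one_apply, map_sub, map_sub, proj_one_apply, proj_apply_apply hP₂]
    abel
  refine ⟨?_, hC⟩
  have hmem : centralC P₁ P₂ ψ ∈ suppZero P₁ P₂ := by
    rw [hC]
    refine ⟨(proj_mem_suppComm hP₁ hP₂ (proj_mem_suppComm hP₁ hP₂
      (proj_mem_suppComm hP₁ hP₂ ψ.2.1).1).2).1, ?_⟩
    exact proj_apply_apply hP₁ _
  change ((suppZero P₁ P₂).orthogonalProjectionOnto (centralC P₁ P₂ ψ) : H) = _
  exact Submodule.starProjection_eq_self_iff.mpr hmem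

theorem compressedC_mem_Icc {P₁ P₂ : H →L[ℂ] H} (hP₁ : IsStarProjection P₁)
    (hP₂ : IsStarProjection P₂) : 0 ≤ compressedC P₁ P₂ ∧ compressedC P₁ P₂ ≤ 1 := by
  have key : ∀ ψ : suppZero P₁ P₂, ⟪compressedC P₁ P₂ ψ, ψ⟫_ℂ = ⟪P₂ (ψ : H), P₂ ψ⟫_ℂ := by
    intro ψ
    rw [Submodule.coe_inner, (coe_compressedC hP₁ hP₂ ψ).1, (coe_compressedC hP₁ hP₂ ψ).2,
      proj_inner hP₁, proj_one_apply, ← proj_inner hP₂, proj_apply_apply hP₂]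
  constructor
  · rw [ContinuousLinearMap.nonneg_iff_isPositive, ContinuousLinearMap.isPositive_iff_complex]
    intro ψ
    rw [key, inner_self_eq_norm_sq_to_K]
    norm_cast
    simp
  · rw [ContinuousLinearMap.le_def, ContinuousLinearMap.isPositive_iff_complex]
    intro ψ
    have : ⟪(1 - compressedC P₁ P₂) ψ, ψ⟫_ℂ = ⟪(ψ : H) - P₂ ψ, (ψ : H) - P₂ ψ⟫_ℂ := by
      change ⟪ψ - compressedC P₁ P₂ ψ, ψ⟫_ℂ = _
      rw [inner_sub_left, key, Submodule.coe_inner, inner_sub_left, inner_sub_right,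
        inner_sub_right, proj_inner hP₂ ψ (P₂ ψ), proj_apply_apply hP₂, proj_inner hP₂ ψ ψ]
      ring
    rw [this, inner_self_eq_norm_sq_to_K]
    norm_cast
    simp

/-- The vector `ψ ⊗ e₁`. -/
noncomputable def partner (P₁ P₂ : H →L[ℂ] H) (θ : ℝ) (ψ : suppZero P₁ P₂) : H :=
  ((2 / Real.sin θ : ℝ) : ℂ) • (1 - P₁) (P₂ (ψ : H))

/-- On an eigenvector `ψ` of `Θ` at `θ`: `θ` is not a multiple of `π`, and the projections act on
`ψ ⊗ e₀`, `ψ ⊗ e₁` by `(1 + σ_z) / 2` and `(1 + sin θ σ_x + cos θ σ_z) / 2`. -/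
theorem eigen_facts {P₁ P₂ : H →L[ℂ] H} (hP₁ : IsStarProjection P₁) (hP₂ : IsStarProjection P₂)
    {θ : ℝ} {ψ : suppZero P₁ P₂} (h : angleOp P₁ P₂ ψ = (θ : ℂ) • ψ) :
    (ψ ≠ 0 → Real.sin θ ≠ 0) ∧
    P₂ (ψ : H) = (((1 + Real.cos θ) / 2 : ℝ) : ℂ) • (ψ : H)
      + ((Real.sin θ / 2 : ℝ) : ℂ) • partner P₁ P₂ θ ψ ∧
    P₁ (partner P₁ P₂ θ ψ) = 0 ∧
    P₂ (partner P₁ P₂ θ ψ) = ((Real.sin θ / 2 : ℝ) : ℂ) • (ψ : H)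
      + (((1 - Real.cos θ) / 2 : ℝ) : ℂ) • partner P₁ P₂ θ ψ := by
  have hc := arccosOp_apply_eq (compressedC_mem_Icc hP₁ hP₂).1 (compressedC_mem_Icc hP₁ hP₂).2 h
  have hc' : P₁ (P₂ (ψ : H)) = (((1 + Real.cos θ) / 2 : ℝ) : ℂ) • (ψ : H) := by
    have := congrArg (Subtype.val) hc
    rw [(coe_compressedC hP₁ hP₂ ψ).1, (coe_compressedC hP₁ hP₂ ψ).2, proj_one_apply] at this
    exact this
  have hn : ⟪P₂ (ψ : H), P₂ ψ⟫_ℂ = (((1 + Real.cos θ) / 2 : ℝ) : ℂ) * ⟪(ψ : H), ψ⟫_ℂ := by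
    rw [proj_inner hP₂, proj_apply_apply hP₂, ← proj_one_apply ψ, proj_inner hP₁,
      proj_one_apply ψ, hc', inner_smul_right]
  have hs : ψ ≠ 0 → Real.sin θ ≠ 0 := by
    intro h0 hs
    apply h0
    have hz : ∀ y : H, P₂ (ψ : H) = y → (y = 0 ∨ y = ψ) → ψ = 0 := by
      rintro y hy (rfl | rfl)
      · exact Subtype.ext (suppComm_eq_zero ψ.2.1 (by rw [proj_one_apply, hy, map_zero]))
      · exact Subtype.ext (suppComm_eq_zero ψ.2.1 (by rw [proj_one_apply, hy, proj_one_apply]))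
    refine hz _ rfl ?_
    rcases Real.sin_eq_zero_iff_cos_eq.mp hs with hco | hco
    · right
      rw [hco] at hn
      norm_num at hn
      rw [← sub_eq_zero, ← inner_self_eq_zero (𝕜 := ℂ), inner_sub_left, inner_sub_right,
        inner_sub_right, proj_inner hP₂ ψ ψ, ← proj_apply_apply hP₂ (ψ : H), ← proj_inner hP₂ ψ,
        proj_apply_apply hP₂]
      simp [hn]
    · left
      rw [hco] at hn
      norm_num at hn
      exact hn
  have h2 : P₂ (ψ : H) = (((1 + Real.cos θ) / 2 : ℝ) : ℂ) • (ψ : H)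
      + ((Real.sin θ / 2 : ℝ) : ℂ) • partner P₁ P₂ θ ψ := by
    by_cases h0 : ψ = 0
    · subst h0; simp [partner]
    · have := hs h0
      rw [partner, smul_smul, ← Complex.ofReal_mul,
        show Real.sin θ / 2 * (2 / Real.sin θ) = 1 by field_simp, Complex.ofReal_one, one_smul,
        ← hc']
      change _ = _ + (P₂ (ψ : H) - P₁ (P₂ ψ))
      abel
  refine ⟨hs, h2, ?_, ?_⟩
  · rw [partner, map_smul]
    change _ • P₁ (P₂ (ψ : H) - P₁ (P₂ ψ)) = 0
    rw [map_sub, proj_apply_apply hP₁, sub_self, smul_zero]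
  · by_cases h0 : ψ = 0
    · subst h0; simp [partner]
    · have hs0 := hs h0
      have e : P₂ (partner P₁ P₂ θ ψ) =
          ((2 / Real.sin θ * ((1 - Real.cos θ) / 2) : ℝ) : ℂ) • P₂ (ψ : H) := by
        rw [partner, map_smul]
        change _ • P₂ (P₂ (ψ : H) - P₁ (P₂ ψ)) = _
        rw [hc', map_sub, proj_apply_apply hP₂, map_smul, Complex.ofReal_mul, mul_smul]
        congr 1
        nth_rewrite 1 [← one_smul ℂ (P₂ (ψ : H))]
        rw [← sub_smul]
        congr 1
        push_cast; ring
      rw [e, h2, smul_add, smul_smul, smul_smul, ← Complex.ofReal_mul, ← Complex.ofReal_mul]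
      have e1 : 2 / Real.sin θ * ((1 - Real.cos θ) / 2) * ((1 + Real.cos θ) / 2)
          = Real.sin θ / 2 := by
        have := Real.sin_sq_add_cos_sq θ
        field_simp
        nlinarith
      have e2 : 2 / Real.sin θ * ((1 - Real.cos θ) / 2) * (Real.sin θ / 2)
          = (1 - Real.cos θ) / 2 := by
        field_simp
      rw [e1, e2]

theorem tensorVec_eq (P₁ P₂ : H →L[ℂ] H) (θ : ℝ) (ψ : suppZero P₁ P₂) (x : Fin 2 → ℂ) :
    tensorVec P₁ P₂ θ ψ x = x 0 • (ψ : H) + x 1 • partner P₁ P₂ θ ψ :=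
  rfl

/-- `M_{P₁}(θ) = (1 + σ_z) / 2`. -/
theorem isFiber_one {P₁ P₂ : H →L[ℂ] H} (hP₁ : IsStarProjection P₁) (hP₂ : IsStarProjection P₂)
    (θ : ℝ) : IsFiber P₁ P₂ P₁ θ ((1 / 2 : ℂ) • (1 + pauli 2)) := by
  intro ψ h x
  obtain ⟨-, -, h1, -⟩ := eigen_facts hP₁ hP₂ h
  rw [tensorVec_eq, tensorVec_eq, map_add, map_smul, map_smul, h1, proj_one_apply]
  simp [Matrix.mulVec, dotProduct, pauli, Fin.sum_univ_two]
  norm_num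

/-- `M_{P₂}(θ) = (1 + sin θ σ_x + cos θ σ_z) / 2`. -/
theorem isFiber_two {P₁ P₂ : H →L[ℂ] H} (hP₁ : IsStarProjection P₁) (hP₂ : IsStarProjection P₂)
    (θ : ℝ) : IsFiber P₁ P₂ P₂ θ
      ((1 / 2 : ℂ) • (1 + (Real.sin θ : ℂ) • pauli 0 + (Real.cos θ : ℂ) • pauli 2)) := by
  intro ψ h x
  obtain ⟨-, h1, -, h2⟩ := eigen_facts hP₁ hP₂ h
  rw [tensorVec_eq, tensorVec_eq, map_add, map_smul, map_smul, h1, h2]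
  simp [Matrix.mulVec, dotProduct, pauli, Fin.sum_univ_two]
  module

/-- The identification of `ℋ_θ ⊗ ℂ²` with a subspace of `𝒦` preserves inner products. -/
theorem inner_tensorVec {P₁ P₂ : H →L[ℂ] H} (hP₁ : IsStarProjection P₁)
    (hP₂ : IsStarProjection P₂) {θ : ℝ} {φ ψ : suppZero P₁ P₂}
    (hφ : angleOp P₁ P₂ φ = (θ : ℂ) • φ) (hψ : angleOp P₁ P₂ ψ = (θ : ℂ) • ψ) (x y : Fin 2 → ℂ) :
    ⟪tensorVec P₁ P₂ θ φ x, tensorVec P₁ P₂ θ ψ y⟫_ℂ = ⟪φ, ψ⟫_ℂ * (star x ⬝ᵥ y) := by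
  obtain ⟨hs, h2, h1, h2'⟩ := eigen_facts hP₁ hP₂ hφ
  obtain ⟨-, g2, g1, g2'⟩ := eigen_facts hP₁ hP₂ hψ
  have o1 : ⟪(φ : H), partner P₁ P₂ θ ψ⟫_ℂ = 0 := by
    rw [← proj_one_apply φ, proj_inner hP₁, g1, inner_zero_right]
  have o2 : ⟪partner P₁ P₂ θ φ, (ψ : H)⟫_ℂ = 0 := by
    rw [← proj_one_apply ψ, ← proj_inner hP₁, h1, inner_zero_left]
  have o3 : ⟪partner P₁ P₂ θ φ, partner P₁ P₂ θ ψ⟫_ℂ = ⟪φ, ψ⟫_ℂ := by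
    by_cases h0 : φ = 0
    · subst h0; simp [partner]
    · have := proj_inner hP₂ (φ : H) (partner P₁ P₂ θ ψ)
      rw [h2, g2', inner_add_left, inner_add_right, inner_smul_left, inner_smul_left,
        inner_smul_right, inner_smul_right, o1] at this
      simp only [mul_zero, zero_add, add_zero, Complex.conj_ofReal] at this
      refine mul_left_cancel₀ (Complex.ofReal_ne_zero.mpr ?_) this
      exact div_ne_zero (hs h0) two_ne_zero
  rw [tensorVec_eq, tensorVec_eq]
  simp only [inner_add_left, inner_add_right, inner_smul_left, inner_smul_right, o1, o2, o3,
    dotProduct, Fin.sum_univ_two, Pi.star_apply, RCLike.star_def, Submodule.coe_inner]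
  ring

/-- For `A` in the algebra and `θ` in the spectrum of `Θ` the matrix `M_A(θ)` exists and is
unique. -/
theorem existsUnique_isFiber [FiniteDimensional ℂ H] {P₁ P₂ : H →L[ℂ] H}
    (hP₁ : IsStarProjection P₁) (hP₂ : IsStarProjection P₂) {A : H →L[ℂ] H}
    (hA : A ∈ vonNeumannGenerated {P₁, P₂}) {θ : ℝ}
    (hθ : (θ : ℂ) ∈ spectrum ℂ (angleOp P₁ P₂)) :
    ∃! M : Matrix (Fin 2) (Fin 2) ℂ, IsFiber P₁ P₂ A θ M := by
  obtain ⟨ψ, hψ, hψ1⟩ : ∃ ψ : suppZero P₁ P₂, angleOp P₁ P₂ ψ = (θ : ℂ) • ψ ∧ ‖ψ‖ = 1 := by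
    have h' : (θ : ℂ) ∈ spectrum ℂ (angleOp P₁ P₂).toLinearMap := by
      have := AlgEquiv.spectrum_eq (Module.End.toContinuousLinearMap (suppZero P₁ P₂) (𝕜 := ℂ))
        (angleOp P₁ P₂).toLinearMap
      rw [← this]
      exact hθ
    obtain ⟨v, hv⟩ := (Module.End.hasEigenvalue_iff_mem_spectrum.mpr h').exists_hasEigenvector
    refine ⟨((‖v‖⁻¹ : ℝ) : ℂ) • v, ?_, ?_⟩
    · have : angleOp P₁ P₂ v = (θ : ℂ) • v := hv.apply_eq_smul
      rw [map_smul, this, smul_comm]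
    · rw [norm_smul]
      simp [hv.2]
  have hin : ⟪ψ, ψ⟫_ℂ = 1 := by
    rw [inner_self_eq_norm_sq_to_K, hψ1]; simp
  have hcomm : ∀ T : H →L[ℂ] H, T * P₁ = P₁ * T → T * P₂ = P₂ * T → ∀ x, T (A x) = A (T x) := by
    intro T h1 h2 x
    have hA' : A ∈ (vonNeumannGenerated {P₁, P₂} : Set (H →L[ℂ] H)) := hA
    rw [coe_vonNeumannGenerated] at hA'
    have hT : T ∈ (({P₁, P₂} : Set (H →L[ℂ] H)) ∪ star {P₁, P₂}).centralizer := by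
      have e : star ({P₁, P₂} : Set (H →L[ℂ] H)) = {P₁, P₂} := by
        rw [← Set.image_star, Set.image_pair, hP₁.isSelfAdjoint.star_eq, hP₂.isSelfAdjoint.star_eq]
      rw [e, Set.union_self]
      rintro m (rfl | rfl)
      exacts [h1.symm, h2.symm]
    exact congrArg (fun L : H →L[ℂ] H => L x) (hA' T hT)
  let e : Fin 2 → Fin 2 → ℂ := fun i => Pi.single i 1
  let M : Matrix (Fin 2) (Fin 2) ℂ :=
    Matrix.of fun i j => ⟪tensorVec P₁ P₂ θ ψ (e i), A (tensorVec P₁ P₂ θ ψ (e j))⟫_ℂ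
  have hadd : ∀ (φ : suppZero P₁ P₂) (x : Fin 2 → ℂ), tensorVec P₁ P₂ θ φ x =
      ∑ i, x i • tensorVec P₁ P₂ θ φ (e i) := by
    intro φ x
    simp [tensorVec, e, Fin.sum_univ_two]
  refine ⟨M, ?_, ?_⟩
  · intro φ hφ
    obtain ⟨-, h2, h1, h2'⟩ := eigen_facts hP₁ hP₂ hφ
    obtain ⟨-, g2, g1, g2'⟩ := eigen_facts hP₁ hP₂ hψ
    let T : H →L[ℂ] H := (innerSL ℂ (ψ : H)).smulRight (φ : H) +
      (innerSL ℂ (partner P₁ P₂ θ ψ)).smulRight (partner P₁ P₂ θ φ)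
    have hT : ∀ x, T x = ⟪(ψ : H), x⟫_ℂ • (φ : H) +
      ⟪partner P₁ P₂ θ ψ, x⟫_ℂ • partner P₁ P₂ θ φ := fun x => rfl
    have c1 : T * P₁ = P₁ * T := by
      ext x
      change T (P₁ x) = P₁ (T x)
      rw [hT, hT, ← proj_inner hP₁, ← proj_inner hP₁, g1, proj_one_apply, map_add, map_smul,
        map_smul, h1, proj_one_apply, inner_zero_left, smul_zero, zero_smul]
    have c2 : T * P₂ = P₂ * T := by
      ext x
      change T (P₂ x) = P₂ (T x)
      rw [hT, hT, ← proj_inner hP₂, ← proj_inner hP₂, g2, g2', map_add, map_smul,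
        map_smul, h2, h2']
      simp only [inner_add_left, inner_smul_left, Complex.conj_ofReal]
      module
    have hTv : ∀ x, T x = ∑ i, ⟪tensorVec P₁ P₂ θ ψ (e i), x⟫_ℂ • tensorVec P₁ P₂ θ φ (e i) := by
      intro x
      rw [hT]
      simp [tensorVec_eq, e, Fin.sum_univ_two]
    have hTt : ∀ j, T (tensorVec P₁ P₂ θ ψ (e j)) = tensorVec P₁ P₂ θ φ (e j) := by
      intro j
      rw [hTv]
      simp only [inner_tensorVec hP₁ hP₂ hψ hψ, hin]
      fin_cases j <;> simp [e, Fin.sum_univ_two, dotProduct]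
    have hbase : ∀ j, A (tensorVec P₁ P₂ θ φ (e j)) = ∑ i, M i j • tensorVec P₁ P₂ θ φ (e i) := by
      intro j
      rw [← hTt j, ← hcomm T c1 c2, hTv]
      rfl
    intro x
    rw [hadd φ x, hadd φ (M.mulVec x), map_sum]
    simp only [map_smul, hbase, Matrix.mulVec, dotProduct, Fin.sum_univ_two]
    module
  · intro N hN
    ext i j
    have := hN ψ hψ (e j)
    change N i j = ⟪tensorVec P₁ P₂ θ ψ (e i), A (tensorVec P₁ P₂ θ ψ (e j))⟫_ℂ
    rw [this, inner_tensorVec hP₁ hP₂ hψ hψ, hin]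
    fin_cases i <;> fin_cases j <;> simp [e, Fin.sum_univ_two, dotProduct, Matrix.mulVec]

/-- `M_A(θ)` has its defining property. -/
theorem isFiber_fiber [FiniteDimensional ℂ H] {P₁ P₂ : H →L[ℂ] H}
    (hP₁ : IsStarProjection P₁) (hP₂ : IsStarProjection P₂) {A : H →L[ℂ] H}
    (hA : A ∈ vonNeumannGenerated {P₁, P₂}) {θ : ℝ}
    (hθ : (θ : ℂ) ∈ spectrum ℂ (angleOp P₁ P₂)) : IsFiber P₁ P₂ A θ (fiber P₁ P₂ A θ) :=
  Classical.epsilon_spec (existsUnique_isFiber hP₁ hP₂ hA hθ).exists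

end Algebra

end TwoProjections

/-! The problem splits into blocks. On the kernel of [P₁, P₂] the algebra is commutative, and the
orthogonal complement of that kernel is the orthogonal sum of the spaces ℋ_θ ⊗ ℂ², on which A acts
as 1 ⊗ M_A(θ) (`sum_fiberLift_one_add_kerProj`, `commute_mul_kerProj`). Coexistence always amounts
to a four-outcome joint observable, obtained from the atoms of the two outcome sets.

Necessity: for a unit vector ψ in ℋ_θ, compression to the span of ψ ⊗ e₀ and ψ ⊗ e₁ is positive and
unital and sends A to M_A(θ). It turns any joint observable, inside the algebra or not, into a joint
observable of the two matrices. Sufficiency: joint observables of the matrices are lifted to the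
blocks and added up, and on the kernel the products of A, 1 - A with B, 1 - B are used. All these
operators lie in the algebra, which also gives the last claim.

What remains is the qubit criterion. Bloch coordinates turn positive matrices into forward vectors
of Minkowski space, and 𝔠 becomes √Π + E, with Π a product of Minkowski squares and E a quadratic
expression in Minkowski products. If four forward vectors realise a joint observable, then √Π + E ≥
0 is a form of Ptolemy's inequality (`sqrt_minkPi_add_minkE_nonneg`). Conversely, if 0 < Π and E² ≤
Π, there is an explicit solution for which all four vectors have the same Minkowski square; on
non-parallel data this square is a positive multiple of Π - E² (`coneCoexistent_of_sq_minkE_le`). If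
E ≥ 0, multiples of the unit are subtracted until E = 0 or one of the vectors becomes null, and the
null case is a one-parameter problem (`coneCoexistent_of_null`). -/

namespace TwoProjections

/-! ### The forward light cone. -/

section ForwardCone

variable {V : Type*} [NormedAddCommGroup V]

/-- The closed forward light cone. -/
def IsForward (x : ℝ × V) : Prop :=
  ‖x.2‖ ≤ x.1

theorem IsForward.fst_nonneg {x : ℝ × V} (hx : IsForward x) : 0 ≤ x.1 :=
  (norm_nonneg _).trans hx

theorem IsForward.add {x y : ℝ × V} (hx : IsForward x) (hy : IsForward y) : IsForward (x + y) :=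
  (norm_add_le _ _).trans (add_le_add hx hy)

theorem IsForward.smul [NormedSpace ℝ V] {x : ℝ × V} (hx : IsForward x) {c : ℝ} (hc : 0 ≤ c) :
    IsForward (c • x) := by
  change ‖c • x.2‖ ≤ c * x.1
  rw [norm_smul, Real.norm_of_nonneg hc]
  exact mul_le_mul_of_nonneg_left hx hc

theorem IsForward.zero : IsForward (0 : ℝ × V) := by simp [IsForward]

end ForwardCone

/-! ### Minkowski products and Ptolemy's inequality: the necessary condition. -/

section Minkowski

variable {V : Type*} [NormedAddCommGroup V] [InnerProductSpace ℝ V]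

/-- The Minkowski form on `ℝ × V`. -/
noncomputable def mink (x y : ℝ × V) : ℝ :=
  x.1 * y.1 - ⟪x.2, y.2⟫_ℝ

theorem mink_comm (x y : ℝ × V) : mink x y = mink y x := by
  rw [mink, mink, mul_comm, real_inner_comm]

theorem mink_add_left (x y z : ℝ × V) : mink (x + y) z = mink x z + mink y z := by
  simp only [mink, Prod.fst_add, Prod.snd_add, inner_add_left]; ring

theorem mink_add_right (x y z : ℝ × V) : mink x (y + z) = mink x y + mink x z := by
  rw [mink_comm, mink_add_left, mink_comm y, mink_comm z]

theorem mink_sub_left (x y z : ℝ × V) : mink (x - y) z = mink x z - mink y z := by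
  simp only [mink, Prod.fst_sub, Prod.snd_sub, inner_sub_left]; ring

theorem mink_sub_right (x y z : ℝ × V) : mink x (y - z) = mink x y - mink x z := by
  rw [mink_comm, mink_sub_left, mink_comm y, mink_comm z]

theorem mink_smul_left (c : ℝ) (x y : ℝ × V) : mink (c • x) y = c * mink x y := by
  simp only [mink, Prod.smul_fst, Prod.smul_snd, real_inner_smul_left, smul_eq_mul]; ring

theorem mink_smul_right (c : ℝ) (x y : ℝ × V) : mink x (c • y) = c * mink x y := by
  rw [mink_comm, mink_smul_left, mink_comm y]

theorem mink_nonneg {x y : ℝ × V} (hx : IsForward x) (hy : IsForward y) : 0 ≤ mink x y :=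
  sub_nonneg.mpr <| (real_inner_le_norm _ _).trans <|
    mul_le_mul hx hy (norm_nonneg _) hx.fst_nonneg

theorem mink_self (x : ℝ × V) : mink x x = x.1 ^ 2 - ‖x.2‖ ^ 2 := by
  rw [mink, real_inner_self_eq_norm_sq, sq x.1]

/-- A causal vector that has a positive product with a forward vector is forward. -/
theorem IsForward.of_mink_pos {t x : ℝ × V} (ht : IsForward t) (hx : 0 ≤ mink x x)
    (h : 0 < mink t x) : IsForward x := by
  rw [mink_self, sub_nonneg] at hx
  have habs : ‖x.2‖ ≤ |x.1| := by
    rw [← abs_of_nonneg (norm_nonneg x.2)]; exact sq_le_sq.mp hx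
  rcases le_or_gt 0 x.1 with h0 | h0
  · rwa [abs_of_nonneg h0] at habs
  · have hneg : IsForward (-x) := by
      rw [abs_of_neg h0] at habs
      change ‖-x.2‖ ≤ -x.1
      rwa [norm_neg]
    have := mink_nonneg ht hneg
    have e : mink t (-x) = -mink t x := by
      rw [← neg_one_smul ℝ, mink_smul_right]; ring
    linarith

/-- Scaled to time component one, null vectors are points of the unit sphere, and the Minkowski
product of two of them is half their squared distance. Up to a common factor the claim is then
Ptolemy's inequality for four points. If some time component vanishes, the left side is zero. -/
theorem sqrt_mink_ptolemy_of_null {x : Fin 4 → ℝ × V} (h : ∀ i, ‖(x i).2‖ = (x i).1) :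
    √(mink (x 0) (x 3) * mink (x 1) (x 2)) ≤
      √(mink (x 0) (x 1) * mink (x 2) (x 3)) + √(mink (x 0) (x 2) * mink (x 1) (x 3)) := by
  have hn : ∀ i, 0 ≤ (x i).1 := fun i => h i ▸ norm_nonneg _
  by_cases hz : ∃ i, (x i).1 = 0
  · obtain ⟨i, hi⟩ := hz
    have hx : x i = 0 := Prod.ext hi (norm_eq_zero.mp ((h i).trans hi))
    have hm : ∀ j, mink (x i) (x j) = 0 ∧ mink (x j) (x i) = 0 := by
      intro j; simp [hx, mink]
    have : mink (x 0) (x 3) * mink (x 1) (x 2) = 0 := by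
      fin_cases i
      · exact mul_eq_zero_of_left (hm 3).1 _
      · exact mul_eq_zero_of_right _ (hm 2).1
      · exact mul_eq_zero_of_right _ (hm 1).2
      · exact mul_eq_zero_of_left (hm 0).2 _
    rw [this, Real.sqrt_zero]
    positivity
  · push Not at hz
    have hp : ∀ i, 0 < (x i).1 := fun i => lt_of_le_of_ne (hn i) (hz i).symm
    let y : Fin 4 → V := fun i => (x i).1⁻¹ • (x i).2
    have hd : ∀ i j, mink (x i) (x j) = (x i).1 * (x j).1 * (dist (y i) (y j)) ^ 2 / 2 := by
      intro i j
      have hy : ∀ k, ‖y k‖ = 1 := by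
        intro k
        simp only [y]
        rw [norm_smul, Real.norm_of_nonneg (inv_nonneg.mpr (hn k)), h k,
          inv_mul_cancel₀ (hz k)]
      have e : ⟪y i, y j⟫_ℝ = (x i).1⁻¹ * ((x j).1⁻¹ * ⟪(x i).2, (x j).2⟫_ℝ) := by
        simp only [y, real_inner_smul_left, real_inner_smul_right]; ring
      rw [dist_eq_norm, norm_sub_sq_real, hy, hy, e, mink]
      have := hz i
      have := hz j
      field_simp
      ring
    let D : ℝ := √((x 0).1 * (x 1).1 * (x 2).1 * (x 3).1) / 2
    have hs : ∀ i j k l, (x i).1 * (x j).1 * (x k).1 * (x l).1 =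
        (x 0).1 * (x 1).1 * (x 2).1 * (x 3).1 →
        √(mink (x i) (x j) * mink (x k) (x l)) = D * (dist (y i) (y j) * dist (y k) (y l)) := by
      intro i j k l he
      rw [hd, hd, ← Real.sqrt_sq (by positivity : 0 ≤ D * (dist (y i) (y j) * dist (y k) (y l))),
        mul_pow, div_pow, Real.sq_sqrt (by have := hn 0; have := hn 1; have := hn 2; have := hn 3
                                           positivity), ← he]
      congr 1
      ring
    rw [hs 0 3 1 2 (by ring), hs 0 1 2 3 (by ring), hs 0 2 1 3 (by ring), ← mul_add]
    refine mul_le_mul_of_nonneg_left ?_ (by positivity)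
    -- The cyclic order is 0, 1, 3, 2, so that the diagonals are 03 and 12.
    have := EuclideanGeometry.mul_dist_le_mul_dist_add_mul_dist (y 0) (y 1) (y 3) (y 2)
    rw [dist_comm (y 3) (y 2)] at this
    linarith

/-- Ptolemy's inequality for forward vectors. -/
theorem sqrt_mink_ptolemy {x : Fin 4 → ℝ × V} (h : ∀ i, IsForward (x i)) :
    √(mink (x 0) (x 3) * mink (x 1) (x 2)) ≤
      √(mink (x 0) (x 1) * mink (x 2) (x 3)) + √(mink (x 0) (x 2) * mink (x 1) (x 3)) := by
  let r : Fin 4 → ℝ := fun i => √(mink (x i) (x i))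
  -- Each vector becomes null by an extra spatial component of length `r i`. These components lie in
  -- four mutually orthogonal new directions, so the products of distinct vectors do not change.
  let z : Fin 4 → ℝ × WithLp 2 (V × EuclideanSpace ℝ (Fin 4)) := fun i =>
    ((x i).1, WithLp.toLp 2 ((x i).2, EuclideanSpace.single i (r i)))
  have hz : ∀ i j, i ≠ j → mink (z i) (z j) = mink (x i) (x j) := by
    intro i j hij
    simp [mink, z, WithLp.prod_inner_apply, EuclideanSpace.inner_single_left, hij]
  have hnull : ∀ i, ‖(z i).2‖ = (z i).1 := by
    intro i
    have hi := mink_nonneg (h i) (h i)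
    rw [← Real.sqrt_sq (norm_nonneg (z i).2), ← Real.sqrt_sq (h i).fst_nonneg,
      WithLp.prod_norm_sq_eq_of_L2]
    congr 1
    change ‖(x i).2‖ ^ 2 + ‖EuclideanSpace.single i (r i)‖ ^ 2 = (x i).1 ^ 2
    rw [PiLp.norm_single, Real.norm_eq_abs, sq_abs, Real.sq_sqrt hi, mink_self]
    ring
  have := sqrt_mink_ptolemy_of_null hnull
  rwa [hz 0 3 (by decide), hz 1 2 (by decide), hz 0 1 (by decide), hz 2 3 (by decide),
    hz 0 2 (by decide), hz 1 3 (by decide)] at this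

/-- The part of the coexistence function without the square root, for pairs with `a + a' = b + b'`. -/
noncomputable def minkE (a a' b b' : ℝ × V) : ℝ :=
  -mink a a' * mink b b' + mink a b' * mink a' b + mink a b * mink a' b'

/-- The radicand of the coexistence function. -/
noncomputable def minkPi (a a' b b' : ℝ × V) : ℝ :=
  mink a a * mink a' a' * mink b b * mink b' b'

/-- With p, q, r the three square roots in Ptolemy's inequality, √Π ≥ 4pq and E ≥ 2(p² + q² - r²).
The sum is at least 2((p + q)² - r²), which is nonnegative because r ≤ p + q. -/
theorem sqrt_minkPi_add_minkE_nonneg {g : Fin 4 → ℝ × V} (h : ∀ i, IsForward (g i)) :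
    0 ≤ √(minkPi (g 0 + g 1) (g 2 + g 3) (g 0 + g 2) (g 1 + g 3)) +
      minkE (g 0 + g 1) (g 2 + g 3) (g 0 + g 2) (g 1 + g 3) := by
  have hn : ∀ i j, 0 ≤ mink (g i) (g j) := fun i j => mink_nonneg (h i) (h j)
  have hc : ∀ i j, mink (g i) (g j) = mink (g j) (g i) := fun i j => mink_comm _ _
  set p := √(mink (g 0) (g 1) * mink (g 2) (g 3)) with hp
  set q := √(mink (g 0) (g 2) * mink (g 1) (g 3)) with hq
  set r := √(mink (g 0) (g 3) * mink (g 1) (g 2)) with hr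
  have hpt : r ≤ p + q := sqrt_mink_ptolemy h
  have hp2 : p ^ 2 = mink (g 0) (g 1) * mink (g 2) (g 3) := Real.sq_sqrt (mul_nonneg (hn _ _) (hn _ _))
  have hq2 : q ^ 2 = mink (g 0) (g 2) * mink (g 1) (g 3) := Real.sq_sqrt (mul_nonneg (hn _ _) (hn _ _))
  have hr2 : r ^ 2 = mink (g 0) (g 3) * mink (g 1) (g 2) := Real.sq_sqrt (mul_nonneg (hn _ _) (hn _ _))
  have hp0 : 0 ≤ p := Real.sqrt_nonneg _
  have hq0 : 0 ≤ q := Real.sqrt_nonneg _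
  have hr0 : 0 ≤ r := Real.sqrt_nonneg _
  have hself : ∀ i j, 2 * mink (g i) (g j) ≤ mink (g i + g j) (g i + g j) := by
    intro i j
    rw [mink_add_left, mink_add_right, mink_add_right, hc j i]
    linarith [hn i i, hn j j]
  have hroot : 4 * p * q ≤ √(minkPi (g 0 + g 1) (g 2 + g 3) (g 0 + g 2) (g 1 + g 3)) := by
    apply Real.le_sqrt_of_sq_le
    have e : (4 * p * q) ^ 2 = 2 * mink (g 0) (g 1) * (2 * mink (g 2) (g 3)) *
        (2 * mink (g 0) (g 2)) * (2 * mink (g 1) (g 3)) := by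
      rw [mul_pow, mul_pow, hp2, hq2]; ring
    rw [e, minkPi]
    have k := fun i j => mul_nonneg (zero_le_two (α := ℝ)) (hn i j)
    have k' := fun i j => (k i j).trans (hself i j)
    exact mul_le_mul (mul_le_mul (mul_le_mul (hself 0 1) (hself 2 3) (k _ _) (k' _ _)) (hself 0 2)
      (k _ _) (mul_nonneg (k' _ _) (k' _ _))) (hself 1 3) (k _ _)
      (mul_nonneg (mul_nonneg (k' _ _) (k' _ _)) (k' _ _))
  -- Equality holds when all `g i` are null; every term that contains a square ⟨g i|g i⟩ has a
  -- nonnegative coefficient.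
  have hE : 2 * (p ^ 2 + q ^ 2 - r ^ 2) ≤
      minkE (g 0 + g 1) (g 2 + g 3) (g 0 + g 2) (g 1 + g 3) := by
    rw [hp2, hq2, hr2, minkE]
    simp only [mink_add_left, mink_add_right]
    rw [hc 1 0, hc 2 0, hc 3 0, hc 2 1, hc 3 1, hc 3 2]
    have m : ∀ i j k l, 0 ≤ mink (g i) (g j) * mink (g k) (g l) :=
      fun i j k l => mul_nonneg (hn _ _) (hn _ _)
    nlinarith [m 1 1 0 2, m 1 1 0 3, m 1 1 2 3, m 2 2 0 1, m 2 2 0 3, m 2 2 1 3, m 1 1 2 2,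
      m 0 0 1 2, m 0 0 1 3, m 0 0 2 3, m 3 3 0 1, m 3 3 0 2, m 3 3 1 2, m 0 0 3 3]
  nlinarith [mul_nonneg (sub_nonneg.mpr hpt) (by positivity : 0 ≤ p + q + r)]

end Minkowski

/-! ### Constructing a joint observable in the cone: the sufficient condition. -/

section Sufficiency

variable {V : Type*} [NormedAddCommGroup V]

/-- Coexistence in the cone order: `a = g + (a - g)`, `b = g + (b - g)`, `a' = (b - g) + …`, where
all four summands are forward. -/
def ConeCoexistent (a a' b : ℝ × V) : Prop :=
  ∃ g, IsForward g ∧ IsForward (a - g) ∧ IsForward (b - g) ∧ IsForward (a' - (b - g))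

theorem ConeCoexistent.swap_compl {a a' b : ℝ × V} (h : ConeCoexistent a a' b) :
    ConeCoexistent a' a b := by
  obtain ⟨g, h0, h1, h2, h3⟩ := h
  exact ⟨b - g, h2, h3, by simpa using h0, by simpa using h1⟩

theorem ConeCoexistent.swap {a a' b b' : ℝ × V} (e : a + a' = b + b')
    (h : ConeCoexistent a a' b) : ConeCoexistent b b' a := by
  obtain ⟨g, h0, h1, h2, h3⟩ := h
  refine ⟨g, h0, h2, h1, ?_⟩
  rwa [show b' - (a - g) = a' - (b - g) by rw [← eq_sub_iff_add_eq'] at e; rw [e]; abel]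

/-- The removed multiple of the unit is given back as t/2 to each of the four summands. -/
theorem ConeCoexistent.of_sub {a a' b : ℝ × V} {t : ℝ} (ht : 0 ≤ t)
    (h : ConeCoexistent (a - (t, 0)) (a' - (t, 0)) (b - (t, 0))) : ConeCoexistent a a' b := by
  obtain ⟨g, h0, h1, h2, h3⟩ := h
  have hs : IsForward ((t / 2, 0) : ℝ × V) := by
    change ‖(0 : V)‖ ≤ t / 2
    rw [norm_zero]; positivity
  have e : ((t, 0) : ℝ × V) = (t / 2, 0) + (t / 2, 0) := by ext <;> simp
  refine ⟨g + (t / 2, 0), h0.add hs, ?_, ?_, ?_⟩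
  · convert h1.add hs using 1; rw [e]; abel
  · convert h2.add hs using 1; rw [e]; abel
  · convert h3.add hs using 1; rw [e]; abel

variable [InnerProductSpace ℝ V]

theorem minkE_swap_compl (a a' b b' : ℝ × V) : minkE a' a b b' = minkE a a' b b' := by
  rw [minkE, minkE, mink_comm a' a]; ring

theorem minkE_swap (a a' b b' : ℝ × V) : minkE b b' a a' = minkE a a' b b' := by
  rw [minkE, minkE, mink_comm b a', mink_comm b' a, mink_comm b a, mink_comm b' a']; ring

/-- The spatial parts are linearly dependent. -/
def SpatiallyParallel (a b : ℝ × V) : Prop :=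
  ‖a.2‖ ^ 2 * ‖b.2‖ ^ 2 = ⟪a.2, b.2⟫_ℝ ^ 2

/-- The Jordan product of the spin factor. -/
noncomputable def jordan (a b : ℝ × V) : ℝ × V :=
  (a.1 * b.1 + ⟪a.2, b.2⟫_ℝ, a.1 • b.2 + b.1 • a.2)

/-- For parallel spatial parts the Minkowski square is multiplicative under the Jordan product, as
the determinant is on commuting matrices. -/
theorem isForward_jordan {a b : ℝ × V} (ha : IsForward a) (hb : IsForward b)
    (h : SpatiallyParallel a b) : IsForward (jordan a b) := by
  have ha' := mink_nonneg ha ha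
  have hb' := mink_nonneg hb hb
  rw [mink_self] at ha' hb'
  refine (sq_le_sq₀ (norm_nonneg _) ?_).mp ?_
  · have := (abs_le.mp (abs_real_inner_le_norm a.2 b.2)).1
    have := mul_le_mul ha hb (norm_nonneg _) ha.fst_nonneg
    change 0 ≤ a.1 * b.1 + ⟪a.2, b.2⟫_ℝ
    linarith
  · change ‖a.1 • b.2 + b.1 • a.2‖ ^ 2 ≤ (a.1 * b.1 + ⟪a.2, b.2⟫_ℝ) ^ 2
    rw [norm_add_sq_real, norm_smul, norm_smul, real_inner_smul_left, real_inner_smul_right,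
      mul_pow, mul_pow, Real.norm_eq_abs, Real.norm_eq_abs, sq_abs, sq_abs, real_inner_comm a.2 b.2]
    have h' : ‖a.2‖ ^ 2 * ‖b.2‖ ^ 2 = ⟪a.2, b.2⟫_ℝ ^ 2 := h
    nlinarith [mul_nonneg ha' hb']

/-- This is the commuting case: the four products of a, a' with b, b', divided by the total u, form
a joint observable. -/
theorem coneCoexistent_of_parallel {a a' b b' : ℝ × V} {u : ℝ} (ha : IsForward a)
    (ha' : IsForward a') (hb : IsForward b) (hb' : IsForward b') (ea : a + a' = (u, 0))
    (eb : b + b' = (u, 0)) (h : SpatiallyParallel a b) : ConeCoexistent a a' b := by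
  have ea1 : a.1 + a'.1 = u := congrArg Prod.fst ea
  have eb1 : b.1 + b'.1 = u := congrArg Prod.fst eb
  have ea2 : a'.2 = -a.2 := (neg_eq_of_add_eq_zero_right (congrArg Prod.snd ea)).symm
  have eb2 : b'.2 = -b.2 := (neg_eq_of_add_eq_zero_right (congrArg Prod.snd eb)).symm
  rcases eq_or_ne u 0 with h0 | h0
  · have hb0 : b = 0 := by
      have h1 : b.1 = 0 := by linarith [hb.fst_nonneg, hb'.fst_nonneg]
      refine Prod.ext h1 (norm_le_zero_iff.mp ?_)
      exact hb.trans h1.le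
    subst hb0
    exact ⟨0, .zero, by simpa using ha, by simpa using hb, by simpa using ha'⟩
  · have hu : 0 ≤ u⁻¹ := inv_nonneg.mpr (by linarith [ha.fst_nonneg, ha'.fst_nonneg])
    have e1 : a - u⁻¹ • jordan a b = u⁻¹ • jordan a b' := by
      ext
      · simp only [jordan, Prod.fst_sub, Prod.smul_fst, smul_eq_mul, eb2, inner_neg_right]
        rw [← eb1] at h0 ⊢
        field_simp
        ring
      · simp only [jordan, Prod.snd_sub, Prod.smul_snd, eb2]
        rw [show b'.1 = u - b.1 by linarith]
        have : a.2 = (u⁻¹ * u) • a.2 := by rw [inv_mul_cancel₀ h0, one_smul]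
        nth_rewrite 1 [this]
        module
    have e2 : b - u⁻¹ • jordan a b = u⁻¹ • jordan a' b := by
      ext
      · simp only [jordan, Prod.fst_sub, Prod.smul_fst, smul_eq_mul, ea2, inner_neg_left]
        rw [← ea1] at h0 ⊢
        field_simp
        ring
      · simp only [jordan, Prod.snd_sub, Prod.smul_snd, ea2]
        rw [show a'.1 = u - a.1 by linarith]
        have : b.2 = (u⁻¹ * u) • b.2 := by rw [inv_mul_cancel₀ h0, one_smul]
        nth_rewrite 1 [this]
        module
    have e3 : a' - u⁻¹ • jordan a' b = u⁻¹ • jordan a' b' := by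
      ext
      · simp only [jordan, Prod.fst_sub, Prod.smul_fst, smul_eq_mul, eb2, inner_neg_right]
        rw [← eb1] at h0 ⊢
        field_simp
        ring
      · simp only [jordan, Prod.snd_sub, Prod.smul_snd, eb2]
        rw [show b'.1 = u - b.1 by linarith]
        have : a'.2 = (u⁻¹ * u) • a'.2 := by rw [inv_mul_cancel₀ h0, one_smul]
        nth_rewrite 1 [this]
        module
    refine ⟨u⁻¹ • jordan a b, (isForward_jordan ha hb h).smul hu, ?_, ?_, ?_⟩
    · rw [e1]
      exact (isForward_jordan ha hb' (by simpa [SpatiallyParallel, eb2] using h)).smul hu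
    · rw [e2]
      exact (isForward_jordan ha' hb (by simpa [SpatiallyParallel, ea2] using h)).smul hu
    · rw [e2, e3]
      exact (isForward_jordan ha' hb' (by simpa [SpatiallyParallel, ea2, eb2] using h)).smul hu

/-- A null vector is orthogonal to a forward vector only if Cauchy–Schwarz is an equality for the
spatial parts. -/
theorem mink_pos_of_not_parallel {a b : ℝ × V} (ha : IsForward a) (hb : IsForward b)
    (haa : mink a a = 0) (h : ¬ SpatiallyParallel a b) : 0 < mink a b := by
  refine lt_of_le_of_ne (mink_nonneg ha hb) fun h0 => h ?_
  rw [mink_self] at haa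
  have hbb := mink_nonneg hb hb
  rw [mink_self] at hbb
  have e : ⟪a.2, b.2⟫_ℝ = a.1 * b.1 := by rw [mink] at h0; linarith
  refine le_antisymm ?_ ?_
  · rw [e, mul_pow, ← sub_eq_zero.mp haa]
    nlinarith [mul_nonneg (sq_nonneg a.1) hbb]
  · rw [← mul_pow, ← sq_abs ⟪a.2, b.2⟫_ℝ]
    exact pow_le_pow_left₀ (abs_nonneg _) (abs_real_inner_le_norm _ _) 2

/-- A null a spans an extreme ray, so g is sought as t a with 0 ≤ t ≤ 1. The other two conditions
are 2t⟨a|b⟩ ≤ ⟨b|b⟩ and 2(1 - t)⟨a|b'⟩ ≤ ⟨b'|b'⟩. In the non-parallel case both products with a are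
positive, and a suitable t exists exactly when E ≥ 0. -/
theorem coneCoexistent_of_null {a a' b b' : ℝ × V} {u : ℝ} (ha : IsForward a)
    (ha' : IsForward a') (hb : IsForward b) (hb' : IsForward b') (ea : a + a' = (u, 0))
    (eb : b + b' = (u, 0)) (haa : mink a a = 0) (hE : 0 ≤ minkE a a' b b') :
    ConeCoexistent a a' b := by
  by_cases h : SpatiallyParallel a b
  · exact coneCoexistent_of_parallel ha ha' hb hb' ea eb h
  have eb2 : b'.2 = -b.2 := (neg_eq_of_add_eq_zero_right (congrArg Prod.snd eb)).symm
  have h1 := mink_pos_of_not_parallel ha hb haa h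
  have h2 : 0 < mink a b' :=
    mink_pos_of_not_parallel ha hb' haa (by simpa [SpatiallyParallel, eb2] using h)
  have ea' : a' = b + b' - a := by rw [eb, ← ea]; abel
  have hE' : 2 * mink a b * mink a b' ≤ mink b b * mink a b' + mink b' b' * mink a b := by
    rw [minkE, ea'] at hE
    simp only [mink_add_left, mink_add_right, mink_sub_left, mink_sub_right, haa, mink_comm b' b]
      at hE
    nlinarith
  have hbb := mink_nonneg hb hb
  have hbb' := mink_nonneg hb' hb'
  have hsub : ∀ (c : ℝ × V) (t : ℝ), mink (c - t • a) (c - t • a) = mink c c - 2 * t * mink a c := by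
    intro c t
    simp only [mink_sub_left, mink_sub_right, mink_smul_left, mink_smul_right, haa, mink_comm c a]
    ring
  have hsub' : ∀ (c : ℝ × V) (t : ℝ), mink a (c - t • a) = mink a c := by
    intro c t
    simp only [mink_sub_right, mink_smul_right, haa]
    ring
  -- The largest t allowed by b and by t ≤ 1 is taken; `hE'` says that b' allows it too.
  obtain ⟨t, ht0, ht1, htb, htb'⟩ : ∃ t : ℝ, 0 ≤ t ∧ t ≤ 1 ∧ 0 ≤ mink b b - 2 * t * mink a b ∧
      0 ≤ mink b' b' - 2 * (1 - t) * mink a b' := by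
    rcases le_total 1 (mink b b / (2 * mink a b)) with hl | hl
    · refine ⟨1, zero_le_one, le_rfl, ?_, by simpa using hbb'⟩
      rw [le_div_iff₀ (by positivity)] at hl
      linarith
    · refine ⟨mink b b / (2 * mink a b), by positivity, hl, ?_, ?_⟩
      · rw [show 2 * (mink b b / (2 * mink a b)) * mink a b = mink b b by field_simp, sub_self]
      · rw [show mink b' b' - 2 * (1 - mink b b / (2 * mink a b)) * mink a b' =
          (mink b b * mink a b' + mink b' b' * mink a b - 2 * mink a b * mink a b') / mink a b by
            field_simp; ring]
        exact div_nonneg (by linarith) h1.le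
  have e1 : a - t • a = (1 - t) • a := by rw [sub_smul, one_smul]
  have e2 : a' - (b - t • a) = b' - (1 - t) • a := by rw [ea', sub_smul, one_smul]; abel
  refine ⟨t • a, ha.smul ht0, ?_, ?_, ?_⟩
  · rw [e1]; exact ha.smul (sub_nonneg.mpr ht1)
  · exact ha.of_mink_pos (by rwa [hsub]) (by rwa [hsub'])
  · rw [e2]; exact ha.of_mink_pos (by rwa [hsub]) (by rwa [hsub'])

/-- One of the four vectors is null. Both E and coexistence are invariant under exchanging a with a'
and the two pairs with each other, which moves that vector to the first place. -/
theorem coneCoexistent_of_minkPi_eq_zero {a a' b b' : ℝ × V} {u : ℝ} (ha : IsForward a)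
    (ha' : IsForward a') (hb : IsForward b) (hb' : IsForward b') (ea : a + a' = (u, 0))
    (eb : b + b' = (u, 0)) (h : minkPi a a' b b' = 0) (hE : 0 ≤ minkE a a' b b') :
    ConeCoexistent a a' b := by
  simp only [minkPi, mul_eq_zero] at h
  rcases h with ((h | h) | h) | h
  · exact coneCoexistent_of_null ha ha' hb hb' ea eb h hE
  · refine (coneCoexistent_of_null ha' ha hb hb' (by rwa [add_comm]) eb h ?_).swap_compl
    rwa [minkE_swap_compl]
  · refine (coneCoexistent_of_null hb hb' ha ha' eb ea h ?_).swap (eb.trans ea.symm)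
    rwa [minkE_swap]
  · refine (coneCoexistent_of_null hb' hb ha ha' (by rwa [add_comm]) ea h ?_).swap_compl.swap
      (eb.trans ea.symm)
    rwa [minkE_swap_compl, minkE_swap]

/-- In the non-parallel case g is chosen in the span of the unit, a and b by three linear equations:
2⟨a|g⟩ = ⟨a|a⟩, 2⟨b|g⟩ = ⟨b|b⟩ and 2⟨a'|b - g⟩ = ⟨a'|a'⟩. They make all four summands have the
Minkowski square of g, which is (Π - E²) / (4u²δ) with δ the Gram determinant of the spatial parts.
Each summand has a positive product with a, a' or b, which selects the forward half of the cone. -/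
theorem coneCoexistent_of_sq_minkE_le {a a' b b' : ℝ × V} {u : ℝ} (ha : IsForward a)
    (ha' : IsForward a') (hb : IsForward b) (hb' : IsForward b') (ea : a + a' = (u, 0))
    (eb : b + b' = (u, 0)) (h : 0 < minkPi a a' b b')
    (hE : minkE a a' b b' ^ 2 ≤ minkPi a a' b b') : ConeCoexistent a a' b := by
  by_cases hpar : SpatiallyParallel a b
  · exact coneCoexistent_of_parallel ha ha' hb hb' ea eb hpar
  have hne : ∀ {x y : ℝ}, x * y ≠ 0 → x ≠ 0 ∧ y ≠ 0 := fun h => mul_ne_zero_iff.mp h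
  obtain ⟨h3, hBp⟩ := hne h.ne'
  obtain ⟨h2, hB⟩ := hne h3
  obtain ⟨hA, hAp⟩ := hne h2
  replace hA := lt_of_le_of_ne (mink_nonneg ha ha) hA.symm
  replace hAp := lt_of_le_of_ne (mink_nonneg ha' ha') hAp.symm
  replace hB := lt_of_le_of_ne (mink_nonneg hb hb) hB.symm
  obtain ⟨α, x⟩ := a
  obtain ⟨β, y⟩ := b
  obtain rfl : a' = (u - α, -x) := by rw [← sub_eq_iff_eq_add'.mpr ea.symm]; simp
  obtain rfl : b' = (u - β, -y) := by rw [← sub_eq_iff_eq_add'.mpr eb.symm]; simp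
  have hu : 0 < u := by
    have h1 : 0 ≤ α := ha.fst_nonneg
    have h2 : 0 ≤ u - α := ha'.fst_nonneg
    rw [mink_self] at hA
    dsimp only at hA
    rcases h1.eq_or_lt with h1 | h1
    · rw [← h1] at hA; nlinarith [sq_nonneg ‖x‖]
    · linarith
  set p := ‖x‖ ^ 2 with hp
  set q := ‖y‖ ^ 2 with hq
  set w := ⟪x, y⟫_ℝ with hw
  have hyx : ⟪y, x⟫_ℝ = w := real_inner_comm _ _
  have hδ : 0 < p * q - w ^ 2 := by
    have : w ^ 2 ≤ p * q := by
      rw [hw, hp, hq, ← mul_pow, ← sq_abs]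
      exact pow_le_pow_left₀ (abs_nonneg _) (abs_real_inner_le_norm _ _) 2
    refine lt_of_le_of_ne (sub_nonneg.mpr this) fun h0 => hpar ?_
    exact sub_eq_zero.mp h0.symm
  set δ := p * q - w ^ 2 with hδd
  -- The solution of the three equations: γ is the time component of g, s and t are the products of
  -- its spatial part with x and y, and Cramer's rule gives the coefficients of x and y in g.
  set γ := (2 * u * (α + β) - u ^ 2 - 2 * (α * β - w)) / (2 * u) with hγ
  set s := (2 * α * γ - (α ^ 2 - p)) / 2 with hs
  set t := (2 * β * γ - (β ^ 2 - q)) / 2 with ht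
  let g : ℝ × V := (γ, ((s * q - t * w) / δ) • x + ((t * p - s * w) / δ) • y)
  have hxg : ⟪x, g.2⟫_ℝ = s := by
    simp only [g, inner_add_right, real_inner_smul_right, real_inner_self_eq_norm_sq]
    rw [← hp, ← hw]
    trans s * δ / δ
    · rw [hδd]; ring
    · exact mul_div_cancel_right₀ _ hδ.ne'
  have hyg : ⟪y, g.2⟫_ℝ = t := by
    simp only [g, inner_add_right, real_inner_smul_right, real_inner_self_eq_norm_sq]
    rw [← hq, hyx]
    trans t * δ / δ
    · rw [hδd]; ring
    · exact mul_div_cancel_right₀ _ hδ.ne'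
  have hgg : ‖g.2‖ ^ 2 = (s ^ 2 * q - 2 * s * t * w + t ^ 2 * p) / δ := by
    rw [← real_inner_self_eq_norm_sq]
    nth_rewrite 1 [show g.2 = ((s * q - t * w) / δ) • x + ((t * p - s * w) / δ) • y from rfl]
    rw [inner_add_left, real_inner_smul_left, real_inner_smul_left, hxg, hyg]
    ring
  have hAg : 2 * mink (α, x) g = mink (α, x) (α, x) := by
    rw [mink_self, mink]
    dsimp only
    rw [hxg, ← hp]
    change 2 * (α * γ - s) = _
    rw [hs]
    ring
  have hBg : 2 * mink (β, y) g = mink (β, y) (β, y) := by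
    rw [mink_self, mink]
    dsimp only
    rw [hyg, ← hq]
    change 2 * (β * γ - t) = _
    rw [ht]
    ring
  have hgg0 : 0 ≤ mink g g := by
    have e : mink g g = (minkPi (α, x) (u - α, -x) (β, y) (u - β, -y) -
        minkE (α, x) (u - α, -x) (β, y) (u - β, -y) ^ 2) / (4 * u ^ 2 * δ) := by
      rw [mink_self, hgg]
      simp only [minkPi, minkE, mink, inner_neg_left, inner_neg_right, real_inner_self_eq_norm_sq]
      rw [← hp, ← hq, ← hw]
      change γ ^ 2 - _ = _
      rw [hs, ht, hγ, hδd]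
      rw [hδd] at hδ
      field_simp
      ring
    rw [e]
    exact div_nonneg (sub_nonneg.mpr hE) (by positivity)
  have hcompl : 2 * mink (u - α, -x) ((β, y) - g) = mink (u - α, -x) (u - α, -x) := by
    rw [mink_self, mink]
    simp only [Prod.fst_sub, Prod.snd_sub, inner_neg_left, inner_sub_right, norm_neg, hxg]
    rw [← hp, ← hw]
    change 2 * ((u - α) * (β - γ) - (-w - -s)) = _
    rw [hs, hγ]
    field_simp
    ring
  -- The condition on d is invariant under d ↦ c - d and makes both parts of c have the same
  -- Minkowski square.
  have hsq : ∀ c d : ℝ × V, 2 * mink c d = mink c c →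
      mink (c - d) (c - d) = mink d d ∧ 2 * mink c (c - d) = mink c c := by
    intro c d hcd
    rw [mink_sub_left, mink_sub_right, mink_sub_right, mink_comm d c]
    constructor <;> linarith
  obtain ⟨hA1, hA2⟩ := hsq _ _ hAg
  obtain ⟨hB1, hB2⟩ := hsq _ _ hBg
  obtain ⟨hC1, hC2⟩ := hsq _ _ hcompl
  refine ⟨g, ha.of_mink_pos hgg0 ?_, ha.of_mink_pos ?_ ?_, hb.of_mink_pos ?_ ?_,
    ha'.of_mink_pos ?_ ?_⟩
  · linarith
  · rwa [hA1]
  · linarith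
  · rwa [hB1]
  · linarith
  · rwa [hC1, hB1]
  · linarith

/-- If E < 0, the hypothesis gives E² ≤ Π. If E ≥ 0, the multiple t of the unit removed from all
four vectors grows until E vanishes or the cone boundary is reached, where Π = 0. Each of the two
end points is a solved case, and the unit is given back afterwards. -/
theorem coneCoexistent_of_nonneg {a a' b b' : ℝ × V} {u : ℝ} (ha : IsForward a)
    (ha' : IsForward a') (hb : IsForward b) (hb' : IsForward b') (ea : a + a' = (u, 0))
    (eb : b + b' = (u, 0)) (h : 0 ≤ √(minkPi a a' b b') + minkE a a' b b') :
    ConeCoexistent a a' b := by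
  rcases lt_or_ge (minkE a a' b b') 0 with hE | hE
  · have hpos : 0 < √(minkPi a a' b b') := by linarith
    have hpos' := Real.sqrt_pos.mp hpos
    refine coneCoexistent_of_sq_minkE_le ha ha' hb hb' ea eb hpos' ?_
    rw [← Real.sq_sqrt hpos'.le]
    nlinarith
  · let T : ℝ → ℝ × V := fun t => (t, 0)
    -- The largest t for which all four vectors stay forward; at t = m one of them is null.
    let m : ℝ := min (min (a.1 - ‖a.2‖) (a'.1 - ‖a'.2‖)) (min (b.1 - ‖b.2‖) (b'.1 - ‖b'.2‖))
    have hm0 : 0 ≤ m :=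
      le_min (le_min (sub_nonneg.mpr ha) (sub_nonneg.mpr ha'))
        (le_min (sub_nonneg.mpr hb) (sub_nonneg.mpr hb'))
    have hfw : ∀ {c : ℝ × V} {t : ℝ}, t ≤ c.1 - ‖c.2‖ → IsForward (c - T t) := by
      intro c t hc
      change ‖c.2 - 0‖ ≤ c.1 - t
      rw [sub_zero]; linarith
    have hnull : ∀ {c : ℝ × V}, m = c.1 - ‖c.2‖ → mink (c - T m) (c - T m) = 0 := by
      intro c hc
      rw [mink_self]
      change (c.1 - m) ^ 2 - ‖c.2 - 0‖ ^ 2 = 0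
      rw [sub_zero, hc]; ring
    let e : ℝ → ℝ := fun t => minkE (a - T t) (a' - T t) (b - T t) (b' - T t)
    have hcont : Continuous e := by
      simp only [e, minkE, mink, T, Prod.fst_sub, Prod.snd_sub]
      fun_prop
    have he0 : 0 ≤ e 0 := by
      have : T 0 = 0 := rfl
      simpa only [e, this, sub_zero] using hE
    have hPm : minkPi (a - T m) (a' - T m) (b - T m) (b' - T m) = 0 := by
      simp only [minkPi, mul_eq_zero]
      rcases min_choice (min (a.1 - ‖a.2‖) (a'.1 - ‖a'.2‖)) (min (b.1 - ‖b.2‖) (b'.1 - ‖b'.2‖))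
        with h1 | h1
      · rcases min_choice (a.1 - ‖a.2‖) (a'.1 - ‖a'.2‖) with h2 | h2
        · exact .inl (.inl (.inl (hnull (h1.trans h2))))
        · exact .inl (.inl (.inr (hnull (h1.trans h2))))
      · rcases min_choice (b.1 - ‖b.2‖) (b'.1 - ‖b'.2‖) with h2 | h2
        · exact .inl (.inr (hnull (h1.trans h2)))
        · exact .inr (hnull (h1.trans h2))
    obtain ⟨t, ht0, htm, het, hPt⟩ : ∃ t, 0 ≤ t ∧ t ≤ m ∧ 0 ≤ e t ∧
        (minkPi (a - T t) (a' - T t) (b - T t) (b' - T t) = 0 ∨ e t = 0) := by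
      rcases le_or_gt 0 (e m) with hem | hem
      · exact ⟨m, hm0, le_rfl, hem, .inl hPm⟩
      · obtain ⟨t, ⟨h1, h2⟩, h3⟩ :=
          intermediate_value_Icc' hm0 hcont.continuousOn ⟨hem.le, he0⟩
        exact ⟨t, h1, h2, h3.ge, .inr h3⟩
    have e' : ∀ {c c' : ℝ × V}, c + c' = (u, 0) → (c - T t) + (c' - T t) = (u - 2 * t, 0) := by
      intro c c' hc
      rw [show (c - T t) + (c' - T t) = (c + c') - (T t + T t) by abel, hc]
      ext
      · change u - (t + t) = u - 2 * t
        ring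
      · simp [T]
    have hfa : IsForward (a - T t) := hfw (htm.trans ((min_le_left _ _).trans (min_le_left _ _)))
    have hfa' : IsForward (a' - T t) := hfw (htm.trans ((min_le_left _ _).trans (min_le_right _ _)))
    have hfb : IsForward (b - T t) := hfw (htm.trans ((min_le_right _ _).trans (min_le_left _ _)))
    have hfb' : IsForward (b' - T t) :=
      hfw (htm.trans ((min_le_right _ _).trans (min_le_right _ _)))
    refine ConeCoexistent.of_sub ht0 ?_
    have hP0 : 0 ≤ minkPi (a - T t) (a' - T t) (b - T t) (b' - T t) :=
      mul_nonneg (mul_nonneg (mul_nonneg (mink_nonneg hfa hfa) (mink_nonneg hfa' hfa'))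
        (mink_nonneg hfb hfb)) (mink_nonneg hfb' hfb')
    rcases hP0.eq_or_lt with hP | hP
    · exact coneCoexistent_of_minkPi_eq_zero hfa hfa' hfb hfb' (e' ea) (e' eb) hP.symm het
    · have h0 : minkE (a - T t) (a' - T t) (b - T t) (b' - T t) = 0 :=
        hPt.resolve_left hP.ne'
      refine coneCoexistent_of_sq_minkE_le hfa hfa' hfb hfb' (e' ea) (e' eb) hP ?_
      rw [h0, zero_pow two_ne_zero]
      exact hP.le

end Sufficiency

/-! ### Bloch coordinates: positive 2 × 2 matrices as forward vectors. -/

section Bloch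

open Matrix
open scoped ComplexOrder

/-- The Bloch coordinates `(α, a)` of `(α 1 + a · σ) / 2`. -/
noncomputable def bloch (A : Matrix (Fin 2) (Fin 2) ℂ) : ℝ × EuclideanSpace ℝ (Fin 3) :=
  (blochScalar A, WithLp.toLp 2 (blochVec A))

/-- The matrix `(α 1 + a · σ) / 2`. -/
noncomputable def ofBloch (x : ℝ × EuclideanSpace ℝ (Fin 3)) : Matrix (Fin 2) (Fin 2) ℂ :=
  (1 / 2 : ℂ) • ((x.1 : ℂ) • (1 : Matrix (Fin 2) (Fin 2) ℂ) + ∑ i, (x.2 i : ℂ) • pauli i)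

theorem bloch_add (A B : Matrix (Fin 2) (Fin 2) ℂ) : bloch (A + B) = bloch A + bloch B := by
  ext i
  · simp [bloch, blochScalar]
  · simp [bloch, blochVec, add_mul]

theorem bloch_sub (A B : Matrix (Fin 2) (Fin 2) ℂ) : bloch (A - B) = bloch A - bloch B := by
  rw [eq_sub_iff_add_eq, ← bloch_add, sub_add_cancel]

theorem bloch_ofBloch (x : ℝ × EuclideanSpace ℝ (Fin 3)) : bloch (ofBloch x) = x := by
  obtain ⟨h1, h2⟩ := bloch_of_param x.1 x.2 (ofBloch x) rfl
  ext i
  · exact h1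
  · exact congrFun h2 i

theorem ofBloch_eq (x : ℝ × EuclideanSpace ℝ (Fin 3)) : ofBloch x =
    (1 / 2 : ℂ) • !![(x.1 : ℂ) + x.2 2, x.2 0 - Complex.I * x.2 1;
      x.2 0 + Complex.I * x.2 1, x.1 - x.2 2] := by
  ext i j
  fin_cases i <;> fin_cases j <;> simp [ofBloch, pauli, Fin.sum_univ_three] <;> ring

theorem ofBloch_bloch {A : Matrix (Fin 2) (Fin 2) ℂ} (hA : A.IsHermitian) :
    ofBloch (bloch A) = A := by
  have h := fun i j => hA.apply i j
  have h00 : (A 0 0).im = 0 := by have := congrArg Complex.im (h 0 0); simp at this; linarith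
  have h11 : (A 1 1).im = 0 := by have := congrArg Complex.im (h 1 1); simp at this; linarith
  have h10 : (A 1 0).re = (A 0 1).re := by have := congrArg Complex.re (h 0 1); simpa using this
  have h10' : (A 1 0).im = -(A 0 1).im := by
    have := congrArg Complex.im (h 0 1); simp at this; linarith
  rw [ofBloch_eq]
  ext i j
  fin_cases i <;> fin_cases j <;> apply Complex.ext <;>
    simp [bloch, blochScalar, blochVec, pauli, trace, Matrix.mul_apply, h00, h11, h10, h10'] <;> ring

theorem bloch_one : bloch 1 = (2, 0) := by
  ext i
  · simp [bloch, blochScalar]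
  · fin_cases i <;> simp [bloch, blochVec, pauli, trace]

theorem norm_sq_fin_three (x : EuclideanSpace ℝ (Fin 3)) :
    ‖x‖ ^ 2 = x 0 ^ 2 + x 1 ^ 2 + x 2 ^ 2 := by
  simp [EuclideanSpace.norm_sq_eq, Fin.sum_univ_three]

theorem isHermitian_ofBloch (x : ℝ × EuclideanSpace ℝ (Fin 3)) : (ofBloch x).IsHermitian := by
  rw [ofBloch_eq]
  ext i j
  fin_cases i <;> fin_cases j <;> simp <;> ring

/-- By Cayley–Hamilton a Hermitian A with positive trace equals (Aᴴ A + det A) / tr A, and here 4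
det A is the Minkowski square. With trace zero, a forward vector is zero. -/
theorem posSemidef_ofBloch {x : ℝ × EuclideanSpace ℝ (Fin 3)} (hx : IsForward x) :
    (ofBloch x).PosSemidef := by
  have hd : 0 ≤ x.1 ^ 2 - ‖x.2‖ ^ 2 := by
    have := mink_nonneg hx hx
    rwa [mink_self] at this
  rcases hx.fst_nonneg.eq_or_lt with h0 | h0
  · have h2 : x.2 = 0 := norm_le_zero_iff.mp (h0 ▸ hx : ‖x.2‖ ≤ 0)
    have : ofBloch x = 0 := by
      rw [ofBloch_eq, ← h0, h2]
      ext i j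
      fin_cases i <;> fin_cases j <;> simp
    rw [this]
    exact PosSemidef.zero
  · have key : ofBloch x = ((x.1⁻¹ : ℝ) : ℂ) • ((ofBloch x)ᴴ * ofBloch x +
        (((x.1 ^ 2 - ‖x.2‖ ^ 2) / 4 : ℝ) : ℂ) • (1 : Matrix (Fin 2) (Fin 2) ℂ)) := by
      have h0' : (x.1 : ℂ) ≠ 0 := Complex.ofReal_ne_zero.mpr h0.ne'
      rw [isHermitian_ofBloch x, norm_sq_fin_three, ofBloch_eq]
      ext i j
      fin_cases i <;> fin_cases j <;> simp <;>
        field_simp <;> ring_nf <;> simp only [Complex.I_sq] <;> ring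
    rw [key]
    refine PosSemidef.smul (((posSemidef_conjTranspose_mul_self _).add
      (PosSemidef.one.smul ?_))) ?_
    · exact_mod_cast (by positivity : 0 ≤ (x.1 ^ 2 - ‖x.2‖ ^ 2) / 4)
    · exact_mod_cast (inv_nonneg.mpr h0.le)

/-- The Minkowski square is 4 det A and the time component is tr A, both nonnegative. -/
theorem isForward_bloch {A : Matrix (Fin 2) (Fin 2) ℂ} (hA : A.PosSemidef) :
    IsForward (bloch A) := by
  have hd : ((bloch A).1 ^ 2 - ‖(bloch A).2‖ ^ 2) / 4 = A.det.re := by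
    nth_rewrite 3 [← ofBloch_bloch hA.isHermitian]
    rw [ofBloch_eq, norm_sq_fin_three, Matrix.det_fin_two]
    simp
    ring
  have h1 : 0 ≤ A.det.re := (Complex.nonneg_iff.mp hA.det_nonneg).1
  have h2 : 0 ≤ (bloch A).1 := (Complex.nonneg_iff.mp hA.trace_nonneg).1
  exact (sq_le_sq₀ (norm_nonneg _) h2).mp (by linarith)

theorem blochForm_eq_mink (A B : Matrix (Fin 2) (Fin 2) ℂ) :
    blochForm A B = mink (bloch A) (bloch B) := by
  simp [blochForm, mink, bloch, PiLp.inner_apply, Fin.sum_univ_three, mul_comm]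

theorem coexFun_eq (A B : Matrix (Fin 2) (Fin 2) ℂ) : coexFun A B =
    √(minkPi (bloch A) (bloch (1 - A)) (bloch B) (bloch (1 - B))) +
      minkE (bloch A) (bloch (1 - A)) (bloch B) (bloch (1 - B)) := by
  simp only [coexFun, minkPi, minkE, blochForm_eq_mink]
  ring

theorem coexFun_nonneg_of_sum_eq_one {G : Fin 4 → Matrix (Fin 2) (Fin 2) ℂ}
    (hG : ∀ i, (G i).PosSemidef) (h : G 0 + G 1 + G 2 + G 3 = 1) :
    0 ≤ coexFun (G 0 + G 1) (G 0 + G 2) := by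
  rw [coexFun_eq, show 1 - (G 0 + G 1) = G 2 + G 3 by rw [← h]; abel,
    show 1 - (G 0 + G 2) = G 1 + G 3 by rw [← h]; abel]
  simp only [bloch_add]
  exact sqrt_minkPi_add_minkE_nonneg (g := fun i => bloch (G i)) fun i => isForward_bloch (hG i)

theorem exists_posSemidef_of_coexFun_nonneg {A B : Matrix (Fin 2) (Fin 2) ℂ}
    (hA : A.PosSemidef) (hA' : (1 - A).PosSemidef) (hB : B.PosSemidef) (hB' : (1 - B).PosSemidef)
    (h : 0 ≤ coexFun A B) : ∃ G : Matrix (Fin 2) (Fin 2) ℂ, G.PosSemidef ∧ (A - G).PosSemidef ∧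
      (B - G).PosSemidef ∧ (1 - A - (B - G)).PosSemidef := by
  have e : ∀ C : Matrix (Fin 2) (Fin 2) ℂ, bloch C + bloch (1 - C) = (2, 0) := by
    intro C
    rw [← bloch_add, add_sub_cancel, bloch_one]
  have back : ∀ {C : Matrix (Fin 2) (Fin 2) ℂ}, C.IsHermitian → IsForward (bloch C) →
      C.PosSemidef := by
    intro C hC hf
    rw [← ofBloch_bloch hC]
    exact posSemidef_ofBloch hf
  obtain ⟨g, h0, h1, h2, h3⟩ := coneCoexistent_of_nonneg (isForward_bloch hA)
    (isForward_bloch hA') (isForward_bloch hB) (isForward_bloch hB') (e A) (e B)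
    (by rwa [← coexFun_eq])
  have hg := isHermitian_ofBloch g
  refine ⟨ofBloch g, posSemidef_ofBloch h0, back (hA.isHermitian.sub hg) ?_,
    back (hB.isHermitian.sub hg) ?_, back (hA'.isHermitian.sub (hB.isHermitian.sub hg)) ?_⟩
  · rwa [bloch_sub, bloch_ofBloch]
  · rwa [bloch_sub, bloch_ofBloch]
  · rwa [bloch_sub (1 - A), bloch_sub B, bloch_ofBloch]

end Bloch

/-! ### Coexistence and four-outcome joint observables. -/

section JointObservable

variable {H : Type u} [NormedAddCommGroup H] [InnerProductSpace ℂ H]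

theorem ext_inner_operator {S T : H →L[ℂ] H} (h : ∀ φ ψ, ⟪φ, S ψ⟫_ℂ = ⟪φ, T ψ⟫_ℂ) : S = T :=
  ContinuousLinearMap.ext fun ψ => ext_inner_left ℂ fun φ => h φ ψ

/-- Countable additivity for the constant sequence ∅ makes a constant series summable, so its term
is zero. -/
theorem Observable.empty {Ω : Type v} [MeasurableSpace Ω] (G : Observable Ω H) :
    G.toFun ∅ = 0 := by
  refine ext_inner_operator fun φ ψ => ?_
  have := G.hasSum (fun _ => ∅) (fun _ => .empty) (fun _ _ _ => disjoint_bot_left) φ ψ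
  have h0 := this.summable.tendsto_atTop_zero
  simpa using tendsto_nhds_unique tendsto_const_nhds h0

theorem Observable.union {Ω : Type v} [MeasurableSpace Ω] (G : Observable Ω H) {X Y : Set Ω}
    (hX : MeasurableSet X) (hY : MeasurableSet Y) (h : Disjoint X Y) :
    G.toFun (X ∪ Y) = G.toFun X + G.toFun Y := by
  refine ext_inner_operator fun φ ψ => ?_
  let Z : ℕ → Set Ω := fun n => match n with
    | 0 => X
    | 1 => Y
    | _ => ∅
  have hZ : ⋃ n, Z n = X ∪ Y := by
    refine subset_antisymm (Set.iUnion_subset fun n => ?_) (Set.union_subset ?_ ?_)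
    · match n with
      | 0 => exact Set.subset_union_left
      | 1 => exact Set.subset_union_right
      | _ + 2 => exact Set.empty_subset _
    · exact Set.subset_iUnion Z 0
    · exact Set.subset_iUnion Z 1
  have hs := G.hasSum Z (fun n => by
      match n with
      | 0 => exact hX
      | 1 => exact hY
      | _ + 2 => exact .empty) (fun m n hmn => by
      match m, n with
      | 0, 0 => exact absurd rfl hmn
      | 1, 1 => exact absurd rfl hmn
      | 0, 1 => exact h
      | 1, 0 => exact h.symm
      | _ + 2, _ => exact disjoint_bot_left
      | _, _ + 2 => exact disjoint_bot_right) φ ψ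
  rw [hZ] at hs
  have hf : HasSum (fun n => ⟪φ, G.toFun (Z n) ψ⟫_ℂ)
      (∑ n ∈ Finset.range 2, ⟪φ, G.toFun (Z n) ψ⟫_ℂ) := by
    refine hasSum_sum_of_ne_finset_zero fun n hn => ?_
    match n, hn with
    | 0, hn => simp at hn
    | 1, hn => simp at hn
    | n + 2, _ =>
      change ⟪φ, G.toFun ∅ ψ⟫_ℂ = 0
      rw [G.empty]; simp
  rw [hs.unique hf, Finset.sum_range_succ, Finset.sum_range_one, add_apply, inner_add_right]
  rfl

/-- The four effects are the values on the atoms X ∩ Y, X \ Y, Y \ X and (X ∪ Y)ᶜ. -/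
theorem Coexistent.exists_isJointObservable {A B : H →L[ℂ] H} (h : Coexistent.{u, v} A B) :
    ∃ G, IsJointObservable G A B := by
  obtain ⟨Ω, _, G, X, Y, hX, hY, rfl, rfl⟩ := h
  have hXY := G.union (hX.inter hY) (hX.diff hY) Set.disjoint_sdiff_inter.symm
  have hYX := G.union (hX.inter hY) (hY.diff hX)
    (by rw [Set.inter_comm]; exact Set.disjoint_sdiff_inter.symm)
  have hU := G.union hX (hY.diff hX) Set.disjoint_sdiff_right
  have hC := G.union (hX.union hY) (hX.union hY).compl disjoint_compl_right
  rw [Set.inter_union_sdiff] at hXY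
  rw [Set.inter_comm, Set.inter_union_sdiff, Set.inter_comm] at hYX
  rw [Set.union_sdiff_self] at hU
  rw [Set.union_compl_self, G.univ] at hC
  refine ⟨![G.toFun (X ∩ Y), G.toFun (X \ Y), G.toFun (Y \ X), G.toFun (X ∪ Y)ᶜ], ?_, hXY.symm,
    hYX.symm, ?_⟩
  · intro i
    fin_cases i
    exacts [G.isEffect _ (hX.inter hY), G.isEffect _ (hX.diff hY), G.isEffect _ (hY.diff hX),
      G.isEffect _ (hX.union hY).compl]
  · change G.toFun (X ∩ Y) + G.toFun (X \ Y) + G.toFun (Y \ X) + G.toFun (X ∪ Y)ᶜ = 1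
    rw [← hXY, ← hU, hC]

variable [CompleteSpace H]

open Classical in
/-- The observable on `Fin 4` with given normalised point masses. -/
noncomputable def fourOutcome (G : Fin 4 → (H →L[ℂ] H)) (h0 : ∀ i, 0 ≤ G i) (h1 : ∑ i, G i = 1) :
    letI : MeasurableSpace (ULift.{v} (Fin 4)) := ⊤
    Observable (ULift.{v} (Fin 4)) H :=
  letI : MeasurableSpace (ULift.{v} (Fin 4)) := ⊤
  { toFun := fun X => ∑ i, if ULift.up i ∈ X then G i else 0
    isEffect := by
      intro X _
      constructor
      · refine Finset.sum_nonneg fun i _ => ?_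
        split_ifs
        exacts [h0 i, le_rfl]
      · rw [← h1]
        refine Finset.sum_le_sum fun i _ => ?_
        split_ifs
        exacts [le_rfl, h0 i]
    univ := by simpa using h1
    hasSum := by
      intro X _ hd φ ψ
      have e : ∀ Y : Set (ULift.{v} (Fin 4)),
          ⟪φ, (∑ i, if ULift.up i ∈ Y then G i else 0) ψ⟫_ℂ =
          ∑ i, if ULift.up i ∈ Y then ⟪φ, G i ψ⟫_ℂ else 0 := by
        intro Y
        rw [sum_apply, inner_sum]
        refine Finset.sum_congr rfl fun i _ => ?_
        split_ifs <;> simp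
      simp only [e]
      refine hasSum_sum fun i _ => ?_
      by_cases hi : ∃ n, ULift.up i ∈ X n
      · obtain ⟨n, hn⟩ := hi
        rw [if_pos (Set.mem_iUnion.mpr ⟨n, hn⟩)]
        have : ∀ m, m ≠ n → (if ULift.up i ∈ X m then ⟪φ, G i ψ⟫_ℂ else 0) = 0 := by
          intro m hm
          exact if_neg fun h => Set.disjoint_left.mp (hd m n hm) h hn
        have hs := hasSum_single n this
        rwa [if_pos hn] at hs
      · rw [if_neg (by simpa using hi)]
        have : ∀ m, ULift.up i ∉ X m := fun m hm => hi ⟨m, hm⟩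
        simp only [this, if_false]
        exact hasSum_zero }

theorem IsJointObservable.coexistent {G : Fin 4 → (H →L[ℂ] H)} {A B : H →L[ℂ] H}
    (h : IsJointObservable G A B) : Coexistent.{u, v} A B := by
  obtain ⟨h0, hA, hB, h1⟩ := h
  let m : MeasurableSpace (ULift.{v} (Fin 4)) := ⊤
  refine ⟨ULift.{v} (Fin 4), m,
    fourOutcome G (fun i => (h0 i).1) (by rw [Fin.sum_univ_four, h1]),
    {.up 0, .up 1}, {.up 0, .up 2}, trivial, trivial, ?_, ?_⟩
  · rw [← hA]
    simp [fourOutcome, Fin.sum_univ_four]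
  · rw [← hB]
    simp [fourOutcome, Fin.sum_univ_four]

end JointObservable

/-! ### Compression to one qubit block: necessity for operators. -/

section Compression

variable {H : Type u} [NormedAddCommGroup H] [InnerProductSpace ℂ H]

/-- The matrix `⟪w i, T (w j)⟫`. -/
noncomputable def compression (w : Fin 2 → H) (T : H →L[ℂ] H) : Matrix (Fin 2) (Fin 2) ℂ :=
  Matrix.of fun i j => ⟪w i, T (w j)⟫_ℂ

theorem compression_add (w : Fin 2 → H) (S T : H →L[ℂ] H) :
    compression w (S + T) = compression w S + compression w T := by
  ext i j
  simp [compression]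

variable {P₁ P₂ : H →L[ℂ] H}

/-- The vectors `ψ ⊗ e₀`, `ψ ⊗ e₁`. -/
noncomputable def tensorBasis (P₁ P₂ : H →L[ℂ] H) (θ : ℝ) (ψ : suppZero P₁ P₂) (i : Fin 2) : H :=
  tensorVec P₁ P₂ θ ψ (Pi.single i 1)

theorem tensorBasis_zero (θ : ℝ) (ψ : suppZero P₁ P₂) : tensorBasis P₁ P₂ θ ψ 0 = ψ := by
  simp [tensorBasis, tensorVec]

theorem tensorBasis_one (θ : ℝ) (ψ : suppZero P₁ P₂) :
    tensorBasis P₁ P₂ θ ψ 1 = partner P₁ P₂ θ ψ := by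
  simp [tensorBasis, tensorVec, partner]

variable [CompleteSpace H]

-- Writing T = S⋆ S makes the compression the Gram matrix of the vectors S (w i).
open scoped ComplexOrder in
theorem posSemidef_compression (w : Fin 2 → H) {T : H →L[ℂ] H} (hT : 0 ≤ T) :
    (compression w T).PosSemidef := by
  obtain ⟨S, rfl⟩ := CStarAlgebra.nonneg_iff_eq_star_mul_self.mp hT
  have : compression w (star S * S) = Matrix.gram ℂ fun i => S (w i) := by
    ext i j
    change ⟪w i, (star S) (S (w j))⟫_ℂ = ⟪S (w i), S (w j)⟫_ℂ
    rw [ContinuousLinearMap.star_eq_adjoint, ContinuousLinearMap.adjoint_inner_right]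
  rw [this]
  exact Matrix.posSemidef_gram ℂ _

/-- For a unit vector ψ the pair ψ ⊗ e₀, ψ ⊗ e₁ is orthonormal, so the compression reads off the
entries of M. -/
theorem compression_eq_of_isFiber (hP₁ : IsStarProjection P₁) (hP₂ : IsStarProjection P₂) {θ : ℝ}
    {ψ : suppZero P₁ P₂} (hψ : angleOp P₁ P₂ ψ = (θ : ℂ) • ψ) (h1 : ‖ψ‖ = 1) {A : H →L[ℂ] H}
    {M : Matrix (Fin 2) (Fin 2) ℂ} (hM : IsFiber P₁ P₂ A θ M) :
    compression (tensorBasis P₁ P₂ θ ψ) A = M := by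
  ext i j
  change ⟪tensorVec P₁ P₂ θ ψ _, A (tensorVec P₁ P₂ θ ψ _)⟫_ℂ = M i j
  rw [hM ψ hψ, inner_tensorVec hP₁ hP₂ hψ hψ, inner_self_eq_norm_sq_to_K, h1]
  simp

theorem isFiber_one_matrix (θ : ℝ) : IsFiber P₁ P₂ 1 θ 1 := by
  intro ψ _ x
  simp

theorem exists_unit_eigenvector [FiniteDimensional ℂ H] {θ : ℝ}
    (hθ : (θ : ℂ) ∈ spectrum ℂ (angleOp P₁ P₂)) :
    ∃ ψ : suppZero P₁ P₂, angleOp P₁ P₂ ψ = (θ : ℂ) • ψ ∧ ‖ψ‖ = 1 := by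
  have h' : (θ : ℂ) ∈ spectrum ℂ (angleOp P₁ P₂).toLinearMap := by
    have := AlgEquiv.spectrum_eq (Module.End.toContinuousLinearMap (suppZero P₁ P₂) (𝕜 := ℂ))
      (angleOp P₁ P₂).toLinearMap
    rw [← this]
    exact hθ
  obtain ⟨v, hv⟩ := (Module.End.hasEigenvalue_iff_mem_spectrum.mpr h').exists_hasEigenvector
  refine ⟨((‖v‖⁻¹ : ℝ) : ℂ) • v, ?_, ?_⟩
  · have : angleOp P₁ P₂ v = (θ : ℂ) • v := hv.apply_eq_smul
    rw [map_smul, this, smul_comm]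
  · rw [norm_smul]
    simp [hv.2]

variable [FiniteDimensional ℂ H]

theorem exists_compression_eq_fiber (hP₁ : IsStarProjection P₁) (hP₂ : IsStarProjection P₂) {θ : ℝ}
    (hθ : (θ : ℂ) ∈ spectrum ℂ (angleOp P₁ P₂)) : ∃ w : Fin 2 → H, compression w 1 = 1 ∧
      ∀ A ∈ vonNeumannGenerated {P₁, P₂}, compression w A = fiber P₁ P₂ A θ := by
  obtain ⟨ψ, hψ, h1⟩ := exists_unit_eigenvector hθ
  exact ⟨tensorBasis P₁ P₂ θ ψ, compression_eq_of_isFiber hP₁ hP₂ hψ h1 (isFiber_one_matrix θ),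
    fun A hA => compression_eq_of_isFiber hP₁ hP₂ hψ h1 (isFiber_fiber hP₁ hP₂ hA hθ)⟩

/-- The effects of the joint observable need not lie in the algebra: only A and B must compress to
their fibres, and the compressed effects only have to be positive with sum 1. -/
theorem IsJointObservable.coexFun_nonneg (hP₁ : IsStarProjection P₁) (hP₂ : IsStarProjection P₂)
    {A B : H →L[ℂ] H} (hA : A ∈ vonNeumannGenerated {P₁, P₂})
    (hB : B ∈ vonNeumannGenerated {P₁, P₂}) {G : Fin 4 → (H →L[ℂ] H)}
    (hG : IsJointObservable G A B) {θ : ℝ} (hθ : (θ : ℂ) ∈ spectrum ℂ (angleOp P₁ P₂)) :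
    0 ≤ coexFun (fiber P₁ P₂ A θ) (fiber P₁ P₂ B θ) := by
  obtain ⟨w, hw1, hw⟩ := exists_compression_eq_fiber hP₁ hP₂ hθ
  obtain ⟨h0, hGA, hGB, h1⟩ := hG
  rw [← hw A hA, ← hw B hB, ← hGA, ← hGB, compression_add, compression_add]
  refine coexFun_nonneg_of_sum_eq_one (G := fun i => compression w (G i))
    (fun i => posSemidef_compression w (h0 i).1) ?_
  rw [← compression_add, ← compression_add, ← compression_add, h1, hw1]

end Compression

/-! ### The projection onto the kernel of the commutator. -/

section KerProj

variable {H : Type u} [NormedAddCommGroup H] [InnerProductSpace ℂ H] [FiniteDimensional ℂ H]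
  {P₁ P₂ : H →L[ℂ] H}

/-- The projection onto the kernel of the commutator. -/
noncomputable def kerProj (P₁ P₂ : H →L[ℂ] H) : H →L[ℂ] H :=
  1 - (suppComm P₁ P₂).starProjection

theorem kerProj_apply_mem (x : H) : kerProj P₁ P₂ x ∈ (suppComm P₁ P₂)ᗮ :=
  Submodule.sub_starProjection_mem_orthogonal x

theorem kerProj_apply_of_mem {x : H} (hx : x ∈ (suppComm P₁ P₂)ᗮ) : kerProj P₁ P₂ x = x := by
  change x - (suppComm P₁ P₂).starProjection x = x
  rw [(Submodule.starProjection_apply_eq_zero_iff _).mpr hx, sub_zero]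

theorem kerProj_apply_of_mem_suppComm {x : H} (hx : x ∈ suppComm P₁ P₂) : kerProj P₁ P₂ x = 0 := by
  change x - (suppComm P₁ P₂).starProjection x = 0
  rw [Submodule.starProjection_eq_self_iff.mpr hx, sub_self]

end KerProj

/-! ### Block structure of the algebra generated by two projections. -/

section Structure

variable {H : Type u} [NormedAddCommGroup H] [InnerProductSpace ℂ H] [CompleteSpace H]

/-- With P the projection onto K, invariance under T gives PTP = TP, and the adjoint of the same
identity for T⋆ gives PTP = PT. -/
theorem commute_starProjection {K : Submodule ℂ H} [K.HasOrthogonalProjection] {T : H →L[ℂ] H}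
    (h : ∀ x ∈ K, T x ∈ K) (h' : ∀ x ∈ K, star T x ∈ K) : Commute T K.starProjection := by
  have hfix : ∀ S : H →L[ℂ] H, (∀ x ∈ K, S x ∈ K) →
      K.starProjection * S * K.starProjection = S * K.starProjection := by
    intro S hS
    ext x
    exact Submodule.starProjection_eq_self_iff.mpr
      (hS _ (Submodule.starProjection_apply_mem K x))
  have h1 := hfix T h
  have h2 := congrArg star (hfix (star T) h')
  simp only [star_mul, star_star, (isSelfAdjoint_starProjection K).star_eq] at h2
  rw [← mul_assoc] at h2
  exact h1.symm.trans h2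

theorem _root_.IsStarProjection.commute_star_left {P T : H →L[ℂ] H} (hP : IsStarProjection P)
    (h : Commute T P) : Commute (star T) P := by
  have := h.star_star
  rwa [hP.isSelfAdjoint.star_eq] at this

theorem commute_arccosOp {T S : H →L[ℂ] H} (h : Commute T S) : Commute (arccosOp T) S := by
  refine Commute.cfc_real ?_ _
  rw [two_mul]
  exact (h.add_left h).sub_left (Commute.one_left S)

variable {P₁ P₂ : H →L[ℂ] H}

/-- The working form of the double commutant: membership of an operator is proved by testing it
against everything that commutes with both projections. -/
theorem mem_vonNeumannGenerated_iff (hP₁ : IsStarProjection P₁) (hP₂ : IsStarProjection P₂)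
    {A : H →L[ℂ] H} : A ∈ vonNeumannGenerated {P₁, P₂} ↔
      ∀ T : H →L[ℂ] H, Commute T P₁ → Commute T P₂ → Commute T A := by
  have e : star ({P₁, P₂} : Set (H →L[ℂ] H)) = {P₁, P₂} := by
    rw [← Set.image_star, Set.image_pair, hP₁.isSelfAdjoint.star_eq, hP₂.isSelfAdjoint.star_eq]
  change A ∈ (vonNeumannGenerated {P₁, P₂} : Set (H →L[ℂ] H)) ↔ _
  rw [coe_vonNeumannGenerated, e, Set.union_self]
  constructor
  · intro h T h1 h2
    refine h T ?_
    rintro m (rfl | rfl)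
    exacts [h1.symm, h2.symm]
  · intro h T hT
    exact h T (hT P₁ (.inl rfl)).symm (hT P₂ (.inr rfl)).symm

theorem left_mem_vonNeumannGenerated (hP₁ : IsStarProjection P₁) (hP₂ : IsStarProjection P₂) :
    P₁ ∈ vonNeumannGenerated {P₁, P₂} :=
  (mem_vonNeumannGenerated_iff hP₁ hP₂).mpr fun _ h _ => h

theorem right_mem_vonNeumannGenerated (hP₁ : IsStarProjection P₁) (hP₂ : IsStarProjection P₂) :
    P₂ ∈ vonNeumannGenerated {P₁, P₂} :=
  (mem_vonNeumannGenerated_iff hP₁ hP₂).mpr fun _ _ h => h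

theorem smul_mem_vonNeumannGenerated (hP₁ : IsStarProjection P₁) (hP₂ : IsStarProjection P₂)
    {A : H →L[ℂ] H} (hA : A ∈ vonNeumannGenerated {P₁, P₂}) (c : ℂ) :
    c • A ∈ vonNeumannGenerated {P₁, P₂} := by
  rw [mem_vonNeumannGenerated_iff hP₁ hP₂] at hA ⊢
  exact fun T h1 h2 => (hA T h1 h2).smul_right c

/-- The adjoint of T also commutes with both projections, so it preserves the kernel of the
commutator, and T preserves the orthogonal complement. -/
theorem commutant_apply_mem_suppComm (hP₁ : IsStarProjection P₁) (hP₂ : IsStarProjection P₂)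
    {T : H →L[ℂ] H} (h1 : Commute T P₁) (h2 : Commute T P₂) {x : H} (hx : x ∈ suppComm P₁ P₂) :
    T x ∈ suppComm P₁ P₂ := by
  refine (Submodule.mem_orthogonal _ _).mpr fun y hy => ?_
  rw [← ContinuousLinearMap.adjoint_inner_left, ← ContinuousLinearMap.star_eq_adjoint]
  refine Submodule.inner_right_of_mem_orthogonal ?_ hx
  have hc := ((hP₁.commute_star_left h1).mul_right (hP₂.commute_star_left h2)).sub_right
    ((hP₂.commute_star_left h2).mul_right (hP₁.commute_star_left h1))
  change (P₁ * P₂ - P₂ * P₁) (star T y) = 0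
  have hy' : (P₁ * P₂ - P₂ * P₁) y = 0 := hy
  rw [← mul_apply_eq_comp, ← hc.eq, mul_apply_eq_comp, hy', map_zero]

theorem commutant_apply_mem_suppZero (hP₁ : IsStarProjection P₁) (hP₂ : IsStarProjection P₂)
    {T : H →L[ℂ] H} (h1 : Commute T P₁) (h2 : Commute T P₂) {x : H} (hx : x ∈ suppZero P₁ P₂) :
    T x ∈ suppZero P₁ P₂ := by
  refine ⟨commutant_apply_mem_suppComm hP₁ hP₂ h1 h2 hx.1, ?_⟩
  change P₁ (T x) = T x
  have hx' : P₁ x = x := hx.2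
  rw [← mul_apply_eq_comp, ← h1.eq, mul_apply_eq_comp, hx']

theorem tensorBasis_mem_suppComm (hP₁ : IsStarProjection P₁) (hP₂ : IsStarProjection P₂) (θ : ℝ)
    (ψ : suppZero P₁ P₂) (i : Fin 2) : tensorBasis P₁ P₂ θ ψ i ∈ suppComm P₁ P₂ := by
  have h2 := (proj_mem_suppComm hP₁ hP₂ ψ.2.1).2
  refine Submodule.add_mem _ (Submodule.smul_mem _ _ ψ.2.1)
    (Submodule.smul_mem _ _ (Submodule.smul_mem _ _ ?_))
  exact Submodule.sub_mem _ h2 (proj_mem_suppComm hP₁ hP₂ h2).1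

/-- The eigenspace `ℋ_θ` of the angle operator, as a subspace of `H`. -/
noncomputable def angleSpace (P₁ P₂ : H →L[ℂ] H) (θ : ℝ) : Submodule ℂ H :=
  (Module.End.eigenspace (angleOp P₁ P₂).toLinearMap (θ : ℂ)).map (suppZero P₁ P₂).subtype

theorem mem_angleSpace {θ : ℝ} {x : H} : x ∈ angleSpace P₁ P₂ θ ↔
    ∃ ψ : suppZero P₁ P₂, angleOp P₁ P₂ ψ = (θ : ℂ) • ψ ∧ (ψ : H) = x := by
  simp only [angleSpace, Submodule.mem_map, Module.End.mem_eigenspace_iff]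
  rfl

/-- T restricts to 𝒦₀ and there commutes with C, which acts as P₁ P₂ P₁. It therefore commutes with
Θ, a function of C, and preserves its eigenspaces. -/
theorem commutant_apply_mem_angleSpace (hP₁ : IsStarProjection P₁) (hP₂ : IsStarProjection P₂)
    {T : H →L[ℂ] H} (h1 : Commute T P₁) (h2 : Commute T P₂) {θ : ℝ} {x : H}
    (hx : x ∈ angleSpace P₁ P₂ θ) : T x ∈ angleSpace P₁ P₂ θ := by
  let S : suppZero P₁ P₂ →L[ℂ] suppZero P₁ P₂ := (T ∘L (suppZero P₁ P₂).subtypeL).codRestrict _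
    fun ψ => commutant_apply_mem_suppZero hP₁ hP₂ h1 h2 ψ.2
  have hS : ∀ ψ, (S ψ : H) = T ψ := fun _ => rfl
  have hc : Commute (compressedC P₁ P₂) S := by
    ext ψ
    change (compressedC P₁ P₂ (S ψ) : H) = T (compressedC P₁ P₂ ψ)
    rw [(coe_compressedC hP₁ hP₂ _).1, (coe_compressedC hP₁ hP₂ _).2, (coe_compressedC hP₁ hP₂ _).1,
      (coe_compressedC hP₁ hP₂ _).2, hS]
    have := ((h1.mul_right h2).mul_right h1).eq
    exact (congrArg (fun L : H →L[ℂ] H => L ψ) this).symm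
  have hΘ : Commute (angleOp P₁ P₂) S := commute_arccosOp hc
  obtain ⟨ψ, hψ, rfl⟩ := mem_angleSpace.mp hx
  refine mem_angleSpace.mpr ⟨S ψ, ?_, rfl⟩
  rw [← mul_apply_eq_comp, hΘ.eq, mul_apply_eq_comp, hψ, map_smul]

theorem inner_eq_zero_of_angle_ne {θ θ' : ℝ} (h : θ ≠ θ') {φ ψ : suppZero P₁ P₂}
    (hφ : angleOp P₁ P₂ φ = (θ : ℂ) • φ) (hψ : angleOp P₁ P₂ ψ = (θ' : ℂ) • ψ) :
    ⟪(φ : H), (ψ : H)⟫_ℂ = 0 := by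
  have hs : IsSelfAdjoint (angleOp P₁ P₂) := cfc_predicate _ _
  have := hs.isSymmetric φ ψ
  change ⟪angleOp P₁ P₂ φ, ψ⟫_ℂ = ⟪φ, angleOp P₁ P₂ ψ⟫_ℂ at this
  rw [hφ, hψ, inner_smul_left, inner_smul_right, Complex.conj_ofReal, ← sub_eq_zero, ← sub_mul]
    at this
  rw [← Submodule.coe_inner]
  refine (mul_eq_zero.mp this).resolve_left ?_
  exact_mod_cast sub_ne_zero.mpr h

/-- P₁ separates e₀ from e₁. For two partner vectors, symmetry of P₂ expresses sin θ times their
product through ⟪φ, ψ⟫, which vanishes because Θ is self-adjoint. -/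
theorem inner_tensorBasis_of_angle_ne (hP₁ : IsStarProjection P₁) (hP₂ : IsStarProjection P₂)
    {θ θ' : ℝ} (h : θ ≠ θ') (i j : Fin 2) {φ ψ : suppZero P₁ P₂}
    (hφ : angleOp P₁ P₂ φ = (θ : ℂ) • φ) (hψ : angleOp P₁ P₂ ψ = (θ' : ℂ) • ψ) :
    ⟪tensorBasis P₁ P₂ θ φ i, tensorBasis P₁ P₂ θ' ψ j⟫_ℂ = 0 := by
  obtain ⟨hs, h2, h1, h2'⟩ := eigen_facts hP₁ hP₂ hφ
  obtain ⟨-, g2, g1, g2'⟩ := eigen_facts hP₁ hP₂ hψ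
  have o0 := inner_eq_zero_of_angle_ne h hφ hψ
  have o1 : ⟪(φ : H), partner P₁ P₂ θ' ψ⟫_ℂ = 0 := by
    rw [← proj_one_apply φ, proj_inner hP₁, g1, inner_zero_right]
  have o2 : ⟪partner P₁ P₂ θ φ, (ψ : H)⟫_ℂ = 0 := by
    rw [← proj_one_apply ψ, ← proj_inner hP₁, h1, inner_zero_left]
  have o3 : ⟪partner P₁ P₂ θ φ, partner P₁ P₂ θ' ψ⟫_ℂ = 0 := by
    by_cases h0 : φ = 0
    · subst h0; simp [partner]
    · have := proj_inner hP₂ (φ : H) (partner P₁ P₂ θ' ψ)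
      rw [h2, g2', inner_add_left, inner_add_right, inner_smul_left, inner_smul_left,
        inner_smul_right, inner_smul_right, o1, o0] at this
      simp only [mul_zero, zero_add, add_zero, Complex.conj_ofReal] at this
      exact (mul_eq_zero.mp this).resolve_left
        (Complex.ofReal_ne_zero.mpr (div_ne_zero (hs h0) two_ne_zero))
  fin_cases i <;> fin_cases j <;>
    simp only [Fin.zero_eta, Fin.mk_one, tensorBasis_zero, tensorBasis_one] <;> assumption

variable [FiniteDimensional ℂ H]

theorem eq_zero_of_inner_angleSpace {x : H} (hx : x ∈ suppZero P₁ P₂)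
    (h : ∀ (θ : ℝ) (ψ : suppZero P₁ P₂), angleOp P₁ P₂ ψ = (θ : ℂ) • ψ → ⟪(ψ : H), x⟫_ℂ = 0) :
    x = 0 := by
  have hs : IsSelfAdjoint (angleOp P₁ P₂) := cfc_predicate _ _
  have hsym : (angleOp P₁ P₂).toLinearMap.IsSymmetric := hs.isSymmetric
  have hbot := hsym.orthogonalComplement_iSup_eigenspaces_eq_bot
  have hmem : (⟨x, hx⟩ : suppZero P₁ P₂) ∈
      (⨆ μ, Module.End.eigenspace (angleOp P₁ P₂).toLinearMap μ)ᗮ := by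
    rw [← Submodule.iInf_orthogonal]
    refine (Submodule.mem_iInf _).mpr fun μ => (Submodule.mem_orthogonal _ _).mpr fun ψ hψ => ?_
    by_cases h0 : ψ = 0
    · rw [h0, inner_zero_left]
    · have hev : Module.End.HasEigenvalue (angleOp P₁ P₂).toLinearMap μ :=
        Module.End.hasEigenvalue_of_hasEigenvector ⟨hψ, h0⟩
      have hμ : ((μ.re : ℝ) : ℂ) = μ := Complex.conj_eq_iff_re.mp (hsym.conj_eigenvalue_eq_self hev)
      rw [Submodule.coe_inner]
      refine h μ.re ψ ?_
      rw [hμ]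
      exact Module.End.mem_eigenspace_iff.mp hψ
  rw [hbot, Submodule.mem_bot] at hmem
  exact congrArg Subtype.val hmem

/-- The operators `F 0`, `F 1` such that `(F i)⋆ ψ = ψ ⊗ e i` for `ψ ∈ ℋ_θ`, and `(F i)⋆ = 0` on
the complement of `ℋ_θ`. -/
noncomputable def component (P₁ P₂ : H →L[ℂ] H) (θ : ℝ) : Fin 2 → (H →L[ℂ] H) :=
  ![(angleSpace P₁ P₂ θ).starProjection,
    ((2 / Real.sin θ : ℝ) : ℂ) • ((angleSpace P₁ P₂ θ).starProjection * (P₂ * (1 - P₁)))]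

/-- The commutant is closed under adjoints and preserves ℋ_θ, so the projection onto ℋ_θ lies in the
double commutant. -/
theorem component_mem (hP₁ : IsStarProjection P₁) (hP₂ : IsStarProjection P₂) (θ : ℝ) (i : Fin 2) :
    component P₁ P₂ θ i ∈ vonNeumannGenerated {P₁, P₂} := by
  have he : (angleSpace P₁ P₂ θ).starProjection ∈ vonNeumannGenerated {P₁, P₂} :=
    (mem_vonNeumannGenerated_iff hP₁ hP₂).mpr fun T h1 h2 => commute_starProjection
      (fun _ hx => commutant_apply_mem_angleSpace hP₁ hP₂ h1 h2 hx)
      (fun _ hx => commutant_apply_mem_angleSpace hP₁ hP₂ (hP₁.commute_star_left h1)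
        (hP₂.commute_star_left h2) hx)
  fin_cases i
  · exact he
  · exact smul_mem_vonNeumannGenerated hP₁ hP₂ (mul_mem he (mul_mem
      (right_mem_vonNeumannGenerated hP₁ hP₂)
      (sub_mem (one_mem _) (left_mem_vonNeumannGenerated hP₁ hP₂)))) _

theorem exists_component_apply_eq (θ : ℝ) (i : Fin 2) (x : H) :
    ∃ ψ : suppZero P₁ P₂, angleOp P₁ P₂ ψ = (θ : ℂ) • ψ ∧ (ψ : H) = component P₁ P₂ θ i x := by
  refine mem_angleSpace.mp ?_
  fin_cases i
  · exact Submodule.starProjection_apply_mem _ _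
  · exact Submodule.smul_mem _ _ (Submodule.starProjection_apply_mem _ _)

theorem star_component_apply (hP₁ : IsStarProjection P₁) (hP₂ : IsStarProjection P₂) {θ : ℝ}
    (i : Fin 2) {ψ : suppZero P₁ P₂} (hψ : angleOp P₁ P₂ ψ = (θ : ℂ) • ψ) :
    star (component P₁ P₂ θ i) ψ = tensorBasis P₁ P₂ θ ψ i := by
  have he : (angleSpace P₁ P₂ θ).starProjection (ψ : H) = ψ :=
    Submodule.starProjection_eq_self_iff.mpr (mem_angleSpace.mpr ⟨ψ, hψ, rfl⟩)
  fin_cases i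
  · change star (angleSpace P₁ P₂ θ).starProjection (ψ : H) = tensorVec P₁ P₂ θ ψ _
    rw [(isSelfAdjoint_starProjection _).star_eq, he]
    simp [tensorVec]
  · change star (((2 / Real.sin θ : ℝ) : ℂ) •
      ((angleSpace P₁ P₂ θ).starProjection * (P₂ * (1 - P₁)))) (ψ : H) = tensorVec P₁ P₂ θ ψ _
    rw [star_smul, star_mul, star_mul, star_sub, star_one, hP₁.isSelfAdjoint.star_eq,
      hP₂.isSelfAdjoint.star_eq, (isSelfAdjoint_starProjection _).star_eq, RCLike.star_def,
      Complex.conj_ofReal]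
    change ((2 / Real.sin θ : ℝ) : ℂ) • (1 - P₁) (P₂ ((angleSpace P₁ P₂ θ).starProjection (ψ : H))) = _
    rw [he]
    simp [tensorVec]

/-- Both sides lie in the eigenspace at θ', so it suffices to pair them with vectors φ of that
space. There the adjoint turns φ into φ ⊗ e i, and orthogonality of the blocks finishes the proof.
-/
theorem component_tensorBasis (hP₁ : IsStarProjection P₁) (hP₂ : IsStarProjection P₂) {θ θ' : ℝ}
    (i j : Fin 2) {ψ : suppZero P₁ P₂} (hψ : angleOp P₁ P₂ ψ = (θ : ℂ) • ψ) :
    component P₁ P₂ θ' i (tensorBasis P₁ P₂ θ ψ j) = if θ' = θ ∧ i = j then (ψ : H) else 0 := by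
  have hmem : component P₁ P₂ θ' i (tensorBasis P₁ P₂ θ ψ j) - (if θ' = θ ∧ i = j then (ψ : H) else 0)
      ∈ angleSpace P₁ P₂ θ' := by
    refine Submodule.sub_mem _ (mem_angleSpace.mpr (exists_component_apply_eq θ' i _)) ?_
    split_ifs with h
    · exact mem_angleSpace.mpr ⟨ψ, h.1 ▸ hψ, rfl⟩
    · exact Submodule.zero_mem _
  obtain ⟨φ, hφ, hφe⟩ := mem_angleSpace.mp hmem
  have key : ⟪(φ : H), component P₁ P₂ θ' i (tensorBasis P₁ P₂ θ ψ j)⟫_ℂ =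
      ⟪(φ : H), if θ' = θ ∧ i = j then (ψ : H) else 0⟫_ℂ := by
    rw [← ContinuousLinearMap.adjoint_inner_left, ← ContinuousLinearMap.star_eq_adjoint,
      star_component_apply hP₁ hP₂ i hφ]
    by_cases h : θ' = θ
    · subst h
      rw [tensorBasis, tensorBasis, inner_tensorVec hP₁ hP₂ hφ hψ]
      by_cases hij : i = j
      · simp [hij, Pi.star_single]
      · simp [hij, Pi.star_single, Ne.symm hij]
    · rw [inner_tensorBasis_of_angle_ne hP₁ hP₂ h i j hφ hψ, if_neg (fun h' => h h'.1),
        inner_zero_right]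
  rw [← sub_eq_zero, ← inner_sub_right, ← hφe, inner_self_eq_zero] at key
  rw [← sub_eq_zero, ← hφe, key]

theorem component_apply_of_mem_ker (hP₁ : IsStarProjection P₁) (hP₂ : IsStarProjection P₂) (θ : ℝ)
    (i : Fin 2) {x : H} (hx : x ∈ (suppComm P₁ P₂)ᗮ) : component P₁ P₂ θ i x = 0 := by
  obtain ⟨ψ, hψ, hψe⟩ := exists_component_apply_eq θ i x
  have hmem := tensorBasis_mem_suppComm hP₁ hP₂ θ ψ i
  have : ⟪(ψ : H), component P₁ P₂ θ i x⟫_ℂ = 0 := by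
    rw [← ContinuousLinearMap.adjoint_inner_left, ← ContinuousLinearMap.star_eq_adjoint,
      star_component_apply hP₁ hP₂ i hψ]
    exact Submodule.inner_right_of_mem_orthogonal hmem hx
  rwa [← hψe, inner_self_eq_zero, hψe] at this

/-- The operator that acts as `1 ⊗ M` on `ℋ_θ ⊗ ℂ²` and as `0` on its orthogonal complement. -/
noncomputable def fiberLift (P₁ P₂ : H →L[ℂ] H) (θ : ℝ) (M : Matrix (Fin 2) (Fin 2) ℂ) :
    H →L[ℂ] H :=
  ∑ i, ∑ j, M i j • (star (component P₁ P₂ θ i) * component P₁ P₂ θ j)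

theorem fiberLift_sub (θ : ℝ) (M N : Matrix (Fin 2) (Fin 2) ℂ) :
    fiberLift P₁ P₂ θ (M - N) = fiberLift P₁ P₂ θ M - fiberLift P₁ P₂ θ N := by
  simp only [fiberLift, Matrix.sub_apply, sub_smul, Finset.sum_sub_distrib]

theorem fiberLift_mem (hP₁ : IsStarProjection P₁) (hP₂ : IsStarProjection P₂) (θ : ℝ)
    (M : Matrix (Fin 2) (Fin 2) ℂ) : fiberLift P₁ P₂ θ M ∈ vonNeumannGenerated {P₁, P₂} :=
  sum_mem fun i _ => sum_mem fun j _ => smul_mem_vonNeumannGenerated hP₁ hP₂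
    (mul_mem (star_mem (component_mem hP₁ hP₂ θ i)) (component_mem hP₁ hP₂ θ j)) _

-- With M = Nᴴ N the lift is a sum of operators L⋆ L, where L runs through the combinations of the
-- components given by the rows of N.
open scoped ComplexOrder Matrix in
theorem fiberLift_nonneg (θ : ℝ) {M : Matrix (Fin 2) (Fin 2) ℂ} (hM : M.PosSemidef) :
    0 ≤ fiberLift P₁ P₂ θ M := by
  obtain ⟨N, rfl⟩ : ∃ N : Matrix (Fin 2) (Fin 2) ℂ, M = Nᴴ * N := by
    open scoped MatrixOrder in
    exact CStarAlgebra.nonneg_iff_eq_star_mul_self.mp hM.nonneg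
  have e : fiberLift P₁ P₂ θ (Nᴴ * N) = ∑ k, star (∑ i, N k i • component P₁ P₂ θ i) *
      ∑ i, N k i • component P₁ P₂ θ i := by
    simp only [fiberLift, Fin.sum_univ_two, Matrix.mul_apply, Matrix.conjTranspose_apply, star_add,
      star_smul, add_mul, mul_add, smul_mul_assoc, mul_smul_comm]
    module
  rw [e]
  exact Finset.sum_nonneg fun k _ => star_mul_self_nonneg _

theorem fiberLift_one_apply (hP₁ : IsStarProjection P₁) (hP₂ : IsStarProjection P₂) {θ θ' : ℝ}
    (j : Fin 2) {ψ : suppZero P₁ P₂} (hψ : angleOp P₁ P₂ ψ = (θ : ℂ) • ψ) :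
    fiberLift P₁ P₂ θ' 1 (tensorBasis P₁ P₂ θ ψ j) =
      if θ' = θ then tensorBasis P₁ P₂ θ ψ j else 0 := by
  have e : fiberLift P₁ P₂ θ' 1 (tensorBasis P₁ P₂ θ ψ j) = ∑ i, star (component P₁ P₂ θ' i)
      (component P₁ P₂ θ' i (tensorBasis P₁ P₂ θ ψ j)) := by
    simp [fiberLift, Fin.sum_univ_two]
  rw [e]
  simp only [component_tensorBasis hP₁ hP₂ _ j hψ]
  split_ifs with h
  · subst h
    rw [Finset.sum_eq_single j]
    · simp [star_component_apply hP₁ hP₂ j hψ]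
    · intro i _ hij
      simp [hij]
    · simp
  · simp [h]

/-- Here `fiberLift P₁ P₂ θ 1` is the projection onto the block at θ: it decomposes a vector into
parts ψ ⊗ e j, on which A acts by M. -/
theorem mul_fiberLift_one (hP₁ : IsStarProjection P₁) (hP₂ : IsStarProjection P₂) {θ : ℝ}
    {A : H →L[ℂ] H} {M : Matrix (Fin 2) (Fin 2) ℂ} (hM : IsFiber P₁ P₂ A θ M) :
    A * fiberLift P₁ P₂ θ 1 = fiberLift P₁ P₂ θ M := by
  ext x
  have hA : ∀ j, A (star (component P₁ P₂ θ j) (component P₁ P₂ θ j x)) =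
      ∑ i, M i j • star (component P₁ P₂ θ i) (component P₁ P₂ θ j x) := by
    intro j
    obtain ⟨ψ, hψ, hψe⟩ := exists_component_apply_eq (P₁ := P₁) (P₂ := P₂) θ j x
    rw [← hψe]
    simp only [star_component_apply hP₁ hP₂ _ hψ]
    rw [tensorBasis, hM ψ hψ]
    simp [tensorBasis_zero, tensorBasis_one, tensorVec_eq, Fin.sum_univ_two]
  have e1 : (A * fiberLift P₁ P₂ θ 1) x =
      ∑ j, A (star (component P₁ P₂ θ j) (component P₁ P₂ θ j x)) := by
    simp [fiberLift, Fin.sum_univ_two]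
  have e2 : fiberLift P₁ P₂ θ M x =
      ∑ j, ∑ i, M i j • star (component P₁ P₂ θ i) (component P₁ P₂ θ j x) := by
    rw [Finset.sum_comm]
    simp [fiberLift, Fin.sum_univ_two]
  rw [e1, e2]
  exact Finset.sum_congr rfl fun j _ => hA j

/-- The spectrum of the angle operator, as a set of real numbers. -/
noncomputable def angleSpectrum (P₁ P₂ : H →L[ℂ] H) : Set ℝ :=
  {θ | (θ : ℂ) ∈ spectrum ℂ (angleOp P₁ P₂)}

theorem mem_angleSpectrum_of_eigenvector {θ : ℝ} {ψ : suppZero P₁ P₂}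
    (hψ : angleOp P₁ P₂ ψ = (θ : ℂ) • ψ) (h0 : ψ ≠ 0) : θ ∈ angleSpectrum P₁ P₂ := by
  have := Module.End.hasEigenvalue_iff_mem_spectrum.mp
    (Module.End.hasEigenvalue_of_hasEigenvector
      (⟨Module.End.mem_eigenspace_iff.mpr hψ, h0⟩ :
        Module.End.HasEigenvector (angleOp P₁ P₂).toLinearMap (θ : ℂ) ψ))
  rwa [← AlgEquiv.spectrum_eq (Module.End.toContinuousLinearMap (suppZero P₁ P₂) (𝕜 := ℂ))
      (angleOp P₁ P₂).toLinearMap] at this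

theorem finite_angleSpectrum : (angleSpectrum P₁ P₂).Finite := by
  have h : (spectrum ℂ (angleOp P₁ P₂)).Finite := by
    have := Module.End.finite_spectrum (angleOp P₁ P₂).toLinearMap
    rwa [← AlgEquiv.spectrum_eq (Module.End.toContinuousLinearMap (suppZero P₁ P₂) (𝕜 := ℂ))
      (angleOp P₁ P₂).toLinearMap] at this
  exact h.preimage Complex.ofReal_injective.injOn

/-- The left side fixes the kernel of the commutator and every ψ ⊗ e j. A vector y orthogonal to all
of these lies in 𝒦. Moreover P₁ y and P₁ P₂ y lie in 𝒦₀ and are orthogonal to every eigenvector of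
Θ, hence zero. So the commutator kills y, and y = 0. -/
theorem sum_fiberLift_one_add_kerProj (hP₁ : IsStarProjection P₁) (hP₂ : IsStarProjection P₂) :
    ∑ θ ∈ (finite_angleSpectrum (P₁ := P₁) (P₂ := P₂)).toFinset, fiberLift P₁ P₂ θ 1 +
      kerProj P₁ P₂ = 1 := by
  set W := ∑ θ ∈ (finite_angleSpectrum (P₁ := P₁) (P₂ := P₂)).toFinset, fiberLift P₁ P₂ θ 1 +
      kerProj P₁ P₂ with hW
  have hWx : ∀ x, W x = ∑ θ ∈ (finite_angleSpectrum (P₁ := P₁) (P₂ := P₂)).toFinset,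
      fiberLift P₁ P₂ θ 1 x + kerProj P₁ P₂ x := by
    intro x
    rw [hW, add_apply, sum_apply]
  let S : Submodule ℂ H := LinearMap.eqLocus W.toLinearMap LinearMap.id
  have hS : ∀ x, x ∈ S ↔ W x = x := fun x => Iff.rfl
  have hker : ∀ x ∈ (suppComm P₁ P₂)ᗮ, x ∈ S := by
    intro x hx
    rw [hS, hWx, kerProj_apply_of_mem hx, Finset.sum_eq_zero, zero_add]
    intro θ _
    simp [fiberLift, component_apply_of_mem_ker hP₁ hP₂ θ _ hx]
  have htensor : ∀ (θ : ℝ) (ψ : suppZero P₁ P₂), angleOp P₁ P₂ ψ = (θ : ℂ) • ψ → ∀ j,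
      tensorBasis P₁ P₂ θ ψ j ∈ S := by
    intro θ ψ hψ j
    have hmem := tensorBasis_mem_suppComm hP₁ hP₂ θ ψ j
    by_cases h0 : ψ = 0
    · have : tensorBasis P₁ P₂ θ ψ j = 0 := by subst h0; simp [tensorBasis, tensorVec]
      rw [this]
      exact S.zero_mem
    · rw [hS, hWx, kerProj_apply_of_mem_suppComm hmem, add_zero]
      simp only [fiberLift_one_apply hP₁ hP₂ j hψ]
      rw [Finset.sum_ite_eq', if_pos]
      exact (Set.Finite.mem_toFinset _).mpr (mem_angleSpectrum_of_eigenvector hψ h0)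
  have htop : S = ⊤ := by
    rw [← Submodule.orthogonal_eq_bot_iff, Submodule.eq_bot_iff]
    intro y hy
    have hyS : ∀ x ∈ S, ⟪x, y⟫_ℂ = 0 := (Submodule.mem_orthogonal _ _).mp hy
    have hyK : y ∈ suppComm P₁ P₂ := by
      rw [← Submodule.orthogonal_orthogonal (suppComm P₁ P₂)]
      exact (Submodule.mem_orthogonal _ _).mpr fun x hx => hyS x (hker x hx)
    have hy0 : ∀ (θ : ℝ) (ψ : suppZero P₁ P₂), angleOp P₁ P₂ ψ = (θ : ℂ) • ψ →
        ⟪(ψ : H), y⟫_ℂ = 0 := by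
      intro θ ψ hψ
      rw [← tensorBasis_zero θ]
      exact hyS _ (htensor θ ψ hψ 0)
    have h1 : P₁ y = 0 := by
      refine eq_zero_of_inner_angleSpace
        ⟨(proj_mem_suppComm hP₁ hP₂ hyK).1, proj_apply_apply hP₁ y⟩ fun θ ψ hψ => ?_
      rw [← proj_inner hP₁, proj_one_apply]
      exact hy0 θ ψ hψ
    have h2 : P₁ (P₂ y) = 0 := by
      refine eq_zero_of_inner_angleSpace
        ⟨(proj_mem_suppComm hP₁ hP₂ (proj_mem_suppComm hP₁ hP₂ hyK).2).1,
          proj_apply_apply hP₁ _⟩ fun θ ψ hψ => ?_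
      rw [← proj_inner hP₁, proj_one_apply, ← proj_inner hP₂, (eigen_facts hP₁ hP₂ hψ).2.1,
        inner_add_left, inner_smul_left, inner_smul_left, hy0 θ ψ hψ, ← tensorBasis_one,
        hyS _ (htensor θ ψ hψ 1)]
      simp
    exact suppComm_eq_zero hyK (by rw [h1, h2, map_zero])
  ext x
  have : x ∈ S := htop ▸ Submodule.mem_top
  exact this

theorem eq_sum_fiberLift_add (hP₁ : IsStarProjection P₁) (hP₂ : IsStarProjection P₂)
    {A : H →L[ℂ] H} (hA : A ∈ vonNeumannGenerated {P₁, P₂}) :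
    A = ∑ θ ∈ (finite_angleSpectrum (P₁ := P₁) (P₂ := P₂)).toFinset,
      fiberLift P₁ P₂ θ (fiber P₁ P₂ A θ) + A * kerProj P₁ P₂ := by
  nth_rewrite 1 [← mul_one A]
  rw [← sum_fiberLift_one_add_kerProj hP₁ hP₂, mul_add, Finset.mul_sum]
  congr 1
  refine Finset.sum_congr rfl fun θ hθ => ?_
  exact mul_fiberLift_one hP₁ hP₂ (isFiber_fiber hP₁ hP₂ hA
    (finite_angleSpectrum.mem_toFinset.mp hθ))

theorem commute_kerProj {T : H →L[ℂ] H}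
    (h : ∀ x ∈ suppComm P₁ P₂, T x ∈ suppComm P₁ P₂)
    (h' : ∀ x ∈ suppComm P₁ P₂, star T x ∈ suppComm P₁ P₂) : Commute T (kerProj P₁ P₂) :=
  (Commute.one_right T).sub_right (commute_starProjection h h')

theorem kerProj_mem (hP₁ : IsStarProjection P₁) (hP₂ : IsStarProjection P₂) :
    kerProj P₁ P₂ ∈ vonNeumannGenerated {P₁, P₂} :=
  (mem_vonNeumannGenerated_iff hP₁ hP₂).mpr fun _ h1 h2 => commute_kerProj
    (fun _ hx => commutant_apply_mem_suppComm hP₁ hP₂ h1 h2 hx)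
    (fun _ hx => commutant_apply_mem_suppComm hP₁ hP₂ (hP₁.commute_star_left h1)
      (hP₂.commute_star_left h2) hx)

theorem commute_left_kerProj (hP₁ : IsStarProjection P₁) (hP₂ : IsStarProjection P₂) :
    Commute P₁ (kerProj P₁ P₂) :=
  commute_kerProj (fun _ hx => (proj_mem_suppComm hP₁ hP₂ hx).1)
    (fun _ hx => by rw [hP₁.isSelfAdjoint.star_eq]; exact (proj_mem_suppComm hP₁ hP₂ hx).1)

theorem commute_right_kerProj (hP₁ : IsStarProjection P₁) (hP₂ : IsStarProjection P₂) :
    Commute P₂ (kerProj P₁ P₂) :=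
  commute_kerProj (fun _ hx => (proj_mem_suppComm hP₁ hP₂ hx).2)
    (fun _ hx => by rw [hP₂.isSelfAdjoint.star_eq]; exact (proj_mem_suppComm hP₁ hP₂ hx).2)

theorem mul_mul_kerProj_comm : P₁ * P₂ * kerProj P₁ P₂ = P₂ * P₁ * kerProj P₁ P₂ := by
  ext x
  have h := kerProj_apply_mem (P₁ := P₁) (P₂ := P₂) x
  rw [suppComm, Submodule.orthogonal_orthogonal] at h
  exact sub_eq_zero.mp h

theorem commute_kerProj_of_mem (hP₁ : IsStarProjection P₁) (hP₂ : IsStarProjection P₂)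
    {A : H →L[ℂ] H} (hA : A ∈ vonNeumannGenerated {P₁, P₂}) : Commute A (kerProj P₁ P₂) :=
  ((mem_vonNeumannGenerated_iff hP₁ hP₂).mp hA _ (commute_left_kerProj hP₁ hP₂).symm
    (commute_right_kerProj hP₁ hP₂).symm).symm

/-- On the kernel, with projection Q, the two projections commute, so P₁ Q and P₂ Q are in the
commutant and commute with A. Therefore A Q commutes with P₁ and P₂, that is, it is in the commutant
too, and it commutes with B. -/
theorem commute_mul_kerProj (hP₁ : IsStarProjection P₁) (hP₂ : IsStarProjection P₂)
    {A B : H →L[ℂ] H} (hA : A ∈ vonNeumannGenerated {P₁, P₂})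
    (hB : B ∈ vonNeumannGenerated {P₁, P₂}) : Commute (A * kerProj P₁ P₂) B := by
  have k1 := commute_left_kerProj hP₁ hP₂
  have k2 := commute_right_kerProj hP₁ hP₂
  have kA := commute_kerProj_of_mem hP₁ hP₂ hA
  have c12 : Commute (P₁ * kerProj P₁ P₂) P₂ := by
    change P₁ * kerProj P₁ P₂ * P₂ = P₂ * (P₁ * kerProj P₁ P₂)
    rw [mul_assoc, ← k2.eq, ← mul_assoc, mul_mul_kerProj_comm, mul_assoc]
  have c21 : Commute (P₂ * kerProj P₁ P₂) P₁ := by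
    change P₂ * kerProj P₁ P₂ * P₁ = P₁ * (P₂ * kerProj P₁ P₂)
    rw [mul_assoc, ← k1.eq, ← mul_assoc, ← mul_mul_kerProj_comm, mul_assoc]
  have hA' := (mem_vonNeumannGenerated_iff hP₁ hP₂).mp hA
  have a1 := hA' _ ((Commute.refl P₁).mul_left k1.symm) c12
  have a2 := hA' _ c21 ((Commute.refl P₂).mul_left k2.symm)
  have lift : ∀ {P : H →L[ℂ] H}, Commute P (kerProj P₁ P₂) → Commute (P * kerProj P₁ P₂) A →
      Commute (A * kerProj P₁ P₂) P := by
    intro P k a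
    change A * kerProj P₁ P₂ * P = P * (A * kerProj P₁ P₂)
    rw [mul_assoc, ← k.eq, ← a.eq, mul_assoc, kA.eq]
  exact (mem_vonNeumannGenerated_iff hP₁ hP₂).mp hB _ (lift k1 a1) (lift k2 a2)

theorem kerProj_nonneg : 0 ≤ kerProj P₁ P₂ := by
  have h : IsStarProjection (kerProj P₁ P₂) := isStarProjection_starProjection.one_sub
  exact h.nonneg

theorem mul_kerProj_mul_nonneg (hP₁ : IsStarProjection P₁) (hP₂ : IsStarProjection P₂)
    {A B : H →L[ℂ] H} (hA : A ∈ vonNeumannGenerated {P₁, P₂})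
    (hB : B ∈ vonNeumannGenerated {P₁, P₂}) (hA0 : 0 ≤ A) (hB0 : 0 ≤ B) :
    0 ≤ A * kerProj P₁ P₂ * B :=
  Commute.mul_nonneg (Commute.mul_nonneg hA0 kerProj_nonneg (commute_kerProj_of_mem hP₁ hP₂ hA)) hB0
    (commute_mul_kerProj hP₁ hP₂ hA hB)

end Structure

/-! ### Assembling a joint observable inside the algebra. -/

section Reconstruction

open scoped ComplexOrder

variable {H : Type u} [NormedAddCommGroup H] [InnerProductSpace ℂ H] [CompleteSpace H]
  {P₁ P₂ : H →L[ℂ] H}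

/-- Positivity is enough: four positive operators with sum 1 are each at most 1. -/
theorem isJointObservable_of_nonneg {A B G : H →L[ℂ] H} (h0 : 0 ≤ G) (h1 : 0 ≤ A - G)
    (h2 : 0 ≤ B - G) (h3 : 0 ≤ 1 - A - (B - G)) :
    IsJointObservable ![G, A - G, B - G, 1 - A - (B - G)] A B := by
  have hsum : ∑ i, ![G, A - G, B - G, 1 - A - (B - G)] i = 1 := by
    simp only [Fin.sum_univ_four, Matrix.cons_val]
    abel
  have hn : ∀ i, 0 ≤ ![G, A - G, B - G, 1 - A - (B - G)] i := by
    intro i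
    fin_cases i
    exacts [h0, h1, h2, h3]
  refine ⟨fun i => ⟨hn i, ?_⟩, add_sub_cancel _ _, add_sub_cancel _ _, ?_⟩
  · exact (Finset.single_le_sum (fun j _ => hn j) (Finset.mem_univ i)).trans_eq hsum
  · rw [Fin.sum_univ_four] at hsum
    exact hsum

variable [FiniteDimensional ℂ H]

/-- The first effect is the sum of the lifted qubit solutions plus A Q B, with Q the projection onto
the kernel. The other three decompose in the same way, with A or B replaced by its complement in the
product on the kernel. -/
theorem exists_isJointObservable_of_coexFun_nonneg (hP₁ : IsStarProjection P₁)
    (hP₂ : IsStarProjection P₂) {A B : H →L[ℂ] H} (hA : A ∈ vonNeumannGenerated {P₁, P₂})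
    (hB : B ∈ vonNeumannGenerated {P₁, P₂}) (hAe : IsEffect A) (hBe : IsEffect B)
    (h : ∀ θ : ℝ, (θ : ℂ) ∈ spectrum ℂ (angleOp P₁ P₂) →
      0 ≤ coexFun (fiber P₁ P₂ A θ) (fiber P₁ P₂ B θ)) :
    ∃ G : Fin 4 → (H →L[ℂ] H), IsJointObservable G A B ∧
      ∀ i, G i ∈ vonNeumannGenerated {P₁, P₂} := by
  have hA' : 1 - A ∈ vonNeumannGenerated {P₁, P₂} := sub_mem (one_mem _) hA
  have hB' : 1 - B ∈ vonNeumannGenerated {P₁, P₂} := sub_mem (one_mem _) hB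
  have hex : ∀ θ : ℝ, ∃ M : Matrix (Fin 2) (Fin 2) ℂ, θ ∈ angleSpectrum P₁ P₂ →
      M.PosSemidef ∧ (fiber P₁ P₂ A θ - M).PosSemidef ∧ (fiber P₁ P₂ B θ - M).PosSemidef ∧
      (fiber P₁ P₂ (1 - A) θ - (fiber P₁ P₂ B θ - M)).PosSemidef := by
    intro θ
    by_cases hθ : θ ∈ angleSpectrum P₁ P₂
    · obtain ⟨w, hw1, hw⟩ := exists_compression_eq_fiber hP₁ hP₂ hθ
      have hpos : ∀ C ∈ vonNeumannGenerated {P₁, P₂}, 0 ≤ C → (fiber P₁ P₂ C θ).PosSemidef := by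
        intro C hC h0
        rw [← hw C hC]
        exact posSemidef_compression w h0
      have hcompl : ∀ C ∈ vonNeumannGenerated {P₁, P₂},
          fiber P₁ P₂ (1 - C) θ = 1 - fiber P₁ P₂ C θ := by
        intro C hC
        rw [eq_sub_iff_add_eq, ← hw C hC, ← hw (1 - C) (sub_mem (one_mem _) hC),
          ← compression_add, sub_add_cancel, hw1]
      obtain ⟨M, hM⟩ := exists_posSemidef_of_coexFun_nonneg (hpos A hA hAe.1)
        (by rw [← hcompl A hA]; exact hpos _ hA' (sub_nonneg.mpr hAe.2)) (hpos B hB hBe.1)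
        (by rw [← hcompl B hB]; exact hpos _ hB' (sub_nonneg.mpr hBe.2)) (h θ hθ)
      rw [← hcompl A hA] at hM
      exact ⟨M, fun _ => hM⟩
    -- A dummy value off the spectrum, so that M can be chosen as a function on all of ℝ; only
    -- spectral angles enter the sums.
    · exact ⟨0, fun h => absurd h hθ⟩
  choose M hM using hex
  let S := (finite_angleSpectrum (P₁ := P₁) (P₂ := P₂)).toFinset
  have hS : ∀ θ ∈ S, θ ∈ angleSpectrum P₁ P₂ := fun θ hθ => finite_angleSpectrum.mem_toFinset.mp hθ
  let Q := kerProj P₁ P₂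
  have hsum : ∀ (N : ℝ → Matrix (Fin 2) (Fin 2) ℂ), (∀ θ ∈ S, (N θ).PosSemidef) →
      0 ≤ ∑ θ ∈ S, fiberLift P₁ P₂ θ (N θ) :=
    fun N hN => Finset.sum_nonneg fun θ hθ => fiberLift_nonneg θ (hN θ hθ)
  let G : H →L[ℂ] H := ∑ θ ∈ S, fiberLift P₁ P₂ θ (M θ) + A * Q * B
  have eAQ : A * Q * B = B * (A * Q) := (commute_mul_kerProj hP₁ hP₂ hA hB).eq
  have eBQ : B * Q = Q * B := (commute_kerProj_of_mem hP₁ hP₂ hB).eq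
  have e1 : A - G = ∑ θ ∈ S, fiberLift P₁ P₂ θ (fiber P₁ P₂ A θ - M θ) + A * Q * (1 - B) := by
    nth_rewrite 1 [eq_sum_fiberLift_add hP₁ hP₂ hA]
    simp only [G, fiberLift_sub, Finset.sum_sub_distrib, mul_sub, mul_one]
    abel
  have e2 : B - G = ∑ θ ∈ S, fiberLift P₁ P₂ θ (fiber P₁ P₂ B θ - M θ) + (1 - A) * Q * B := by
    nth_rewrite 1 [eq_sum_fiberLift_add hP₁ hP₂ hB]
    change _ + B * Q - _ = _
    rw [eBQ]
    simp only [G, fiberLift_sub, Finset.sum_sub_distrib, sub_mul, one_mul]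
    abel
  have e3 : 1 - A - (B - G) = ∑ θ ∈ S, fiberLift P₁ P₂ θ
      (fiber P₁ P₂ (1 - A) θ - (fiber P₁ P₂ B θ - M θ)) + (1 - A) * Q * (1 - B) := by
    nth_rewrite 1 [e2, eq_sum_fiberLift_add hP₁ hP₂ hA']
    simp only [fiberLift_sub, Finset.sum_sub_distrib, mul_sub, mul_one]
    abel
  refine ⟨_, isJointObservable_of_nonneg (G := G) ?_ ?_ ?_ ?_, ?_⟩
  · exact add_nonneg (hsum _ fun θ hθ => (hM θ (hS θ hθ)).1)
      (mul_kerProj_mul_nonneg hP₁ hP₂ hA hB hAe.1 hBe.1)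
  · rw [e1]
    exact add_nonneg (hsum _ fun θ hθ => (hM θ (hS θ hθ)).2.1)
      (mul_kerProj_mul_nonneg hP₁ hP₂ hA hB' hAe.1 (sub_nonneg.mpr hBe.2))
  · rw [e2]
    exact add_nonneg (hsum _ fun θ hθ => (hM θ (hS θ hθ)).2.2.1)
      (mul_kerProj_mul_nonneg hP₁ hP₂ hA' hB (sub_nonneg.mpr hAe.2) hBe.1)
  · rw [e3]
    exact add_nonneg (hsum _ fun θ hθ => (hM θ (hS θ hθ)).2.2.2)
      (mul_kerProj_mul_nonneg hP₁ hP₂ hA' hB' (sub_nonneg.mpr hAe.2) (sub_nonneg.mpr hBe.2))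
  · have hG : G ∈ vonNeumannGenerated {P₁, P₂} :=
      add_mem (sum_mem fun θ _ => fiberLift_mem hP₁ hP₂ θ _)
        (mul_mem (mul_mem hA (kerProj_mem hP₁ hP₂)) hB)
    intro i
    fin_cases i
    exacts [hG, sub_mem hA hG, sub_mem hB hG, sub_mem hA' (sub_mem hB hG)]

end Reconstruction

end TwoProjections

-- For the last claim an arbitrary joint observable is not cut down to the algebra: it only yields
-- the inequalities, from which a new one is built.
open TwoProjections in
theorem proposition4p1 {H : Type u} [NormedAddCommGroup H] [InnerProductSpace ℂ H]
    [CompleteSpace H] [FiniteDimensional ℂ H]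
    (P₁ P₂ : H →L[ℂ] H) (hP₁ : IsStarProjection P₁) (hP₂ : IsStarProjection P₂)
    (A B : H →L[ℂ] H) (hA : A ∈ vonNeumannGenerated {P₁, P₂})
    (hB : B ∈ vonNeumannGenerated {P₁, P₂}) (hAe : IsEffect A) (hBe : IsEffect B) :
    (Coexistent.{u, v} A B ↔
      ∀ θ : ℝ, (θ : ℂ) ∈ spectrum ℂ (angleOp P₁ P₂) →
        0 ≤ coexFun (fiber P₁ P₂ A θ) (fiber P₁ P₂ B θ)) ∧
    (Coexistent.{u, v} A B →
      ∃ G : Fin 4 → (H →L[ℂ] H), IsJointObservable G A B ∧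
        ∀ i, G i ∈ vonNeumannGenerated {P₁, P₂}) := by
  have hc : ∀ {G : Fin 4 → (H →L[ℂ] H)}, IsJointObservable G A B → ∀ θ : ℝ,
      (θ : ℂ) ∈ spectrum ℂ (angleOp P₁ P₂) →
        0 ≤ coexFun (fiber P₁ P₂ A θ) (fiber P₁ P₂ B θ) :=
    fun hG θ hθ => hG.coexFun_nonneg hP₁ hP₂ hA hB hθ
  refine ⟨⟨fun h => ?_, fun h => ?_⟩, fun h => ?_⟩
  · obtain ⟨G, hG⟩ := h.exists_isJointObservable
    exact hc hG
  · obtain ⟨G, hG, -⟩ := exists_isJointObservable_of_coexFun_nonneg hP₁ hP₂ hA hB hAe hBe h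
    exact hG.coexistent
  · obtain ⟨G, hG⟩ := h.exists_isJointObservable
    exact exists_isJointObservable_of_coexFun_nonneg hP₁ hP₂ hA hB hAe hBe (hc hG)
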